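/- Let $(\mathcal R,p_R)$ be a discrete memoryless source with countable (for instance finite) alphabet and finite entropy $H(R)$ in bits, and let $\sigma>0$. When the codeword $x^n\in\mathbb R^n$ is sent, the eavesdropper observes $Z^n=x^n+C^n+N^n$, where $N^n$ is i.i.d. $\mathcal N(0,\sigma^2)$ and $C^n=f_n(R^n)$ is the interference of a cooperative jammer; here $f_n:\mathcal R^n\to\mathbb R^n$ is a deterministic map and $R^n$ consists of $n$ independent symbols of the source, independent of $N^n$, which is the only randomness of the jammer. Say that the jammer $(f_n)_n$ induces Gaussian noise of power $\rho\ge 0$ if $$\lim_{n\to\infty}\ \sup_{x^n\in\mathbb R^n}\ \mathbb V\bigl(P_{Z^n\mid x^n},\ \mathcal N(x^n,(\sigma^2+\rho)I_n)\bigr)=0,$$ where $\mathbb V$ is the variational distance. Say that the power $\rho$ is inducible if for every $\delta>0$ there is a jammer $(f_n)_n$ that induces Gaussian noise of power $\rho$, satisfies the average power constraint $\mathbb E\|C^n\|^2\le n\rho$ for every $n$, and for every $n$ takes its sequences from a codebook with at most $2^{n(\frac12\log_2(1+\rho/\sigma^2)+\delta)}$ codewords. Put $\rho^*=\sigma^2\bigl(2^{2H(R)}-1\bigr)$.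 Then: 1. every $\rho$ with $0\le\rho<\rho^*$ is inducible; 2. conversely, if some jammer, with no constraint on its power or on its codebook, induces Gaussian noise of power $\rho\ge 0$, then $\rho\le\rho^*$; 3. consequently $\rho^*$ is the supremum of the inducible powers. -/

import Mathlib

open MeasureTheory ProbabilityTheory Filter Topology

noncomputable section

namespace CoopJam

/-- The Shannon entropy, in bits, of a discrete distribution. -/
def entropyBits {α : Type*} (p : PMF α) : ℝ :=
  (∑' a, Real.negMulLog (p a).toReal) / Real.log 2

/-- The law of `n` output symbols of the discrete memoryless source with distribution `p`. -/
def sourceLaw {α : Type*} [MeasurableSpace α] (p : PMF α) (n : ℕ) : Measure (Fin n → α) :=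
  Measure.pi fun _ => p.toMeasure

/-- The law of `n` independent centered Gaussian variables, each of variance `v`. -/
def noiseLaw (v : ℝ) (n : ℕ) : Measure (Fin n → ℝ) :=
  Measure.pi fun _ => gaussianReal 0 v.toNNReal

/-- The variational (`L¹`) distance between two probability measures, with values in `[0, 2]`:
twice the supremum over all events of the difference of the probabilities. -/
def varDist {Ω : Type*} [MeasurableSpace Ω] (μ ν : Measure Ω) : ℝ :=
  2 * ⨆ s : {s : Set Ω // MeasurableSet s}, |μ.real s.1 - ν.real s.1|

/-- A jammer: for every block length `n`, a deterministic map from `n` source symbols to the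
`n` symbols of the interference. The source is thus the only randomness that the jammer has. -/
abbrev Jammer (α : Type*) := ∀ n : ℕ, (Fin n → α) → (Fin n → ℝ)

/-- The law of the eavesdropper's observation `Zⁿ = xⁿ + Cⁿ + Nⁿ` when the codeword `xⁿ` is sent,
`Cⁿ` is the jammer's interference, and `Nⁿ` is white Gaussian noise of variance `σ ^ 2`,
independent of the source. -/
def jammedLaw {α : Type*} [MeasurableSpace α] (p : PMF α) (σ : ℝ) (f : Jammer α) (n : ℕ)
    (x : Fin n → ℝ) : Measure (Fin n → ℝ) :=
  ((sourceLaw p n).prod (noiseLaw (σ ^ 2) n)).map fun q => x + f n q.1 + q.2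

/-- The law of the output of an ideal additive white Gaussian noise channel with noise variance
`v` when the codeword `xⁿ` is sent. -/
def awgnLaw (v : ℝ) (n : ℕ) (x : Fin n → ℝ) : Measure (Fin n → ℝ) :=
  (noiseLaw v n).map fun w => x + w

/-- The channel that the eavesdropper sees becomes, uniformly over the transmitted codewords,
indistinguishable in variational distance from a Gaussian channel whose noise variance
`σ ^ 2` has been increased by `ρ`. -/
def InducesGaussianNoise {α : Type*} [MeasurableSpace α] (p : PMF α) (σ ρ : ℝ)
    (f : Jammer α) : Prop :=
  ∀ ε : ℝ, 0 < ε → ∀ᶠ n in atTop, ∀ x : Fin n → ℝ,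
    varDist (jammedLaw p σ f n x) (awgnLaw (σ ^ 2 + ρ) n x) ≤ ε

/-- The interference obeys the average power constraint `E ‖Cⁿ‖² ≤ n ρ` at every block length. -/
def AveragePowerLE {α : Type*} [MeasurableSpace α] (p : PMF α) (ρ : ℝ) (f : Jammer α) : Prop :=
  ∀ n : ℕ, ∫⁻ r, ENNReal.ofReal (∑ i, (f n r i) ^ 2) ∂(sourceLaw p n) ≤ ENNReal.ofReal (n * ρ)

/-- At every block length `n` the jamming sequences come from a codebook with at most
`2 ^ (n R)` codewords. -/
def CodebookRateLE {α : Type*} (R : ℝ) (f : Jammer α) : Prop :=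
  ∀ n : ℕ, (Set.range (f n)).Finite ∧ ((Set.range (f n)).ncard : ℝ) ≤ (2 : ℝ) ^ (n * R)

/-- With the memoryless source `p` as its only randomness, a jammer can induce Gaussian noise of
power `ρ` on top of the noise variance `σ ^ 2`, by sequences of average power at most `ρ` from
codebooks of rate arbitrarily close to `½ log₂ (1 + ρ / σ ^ 2)`. -/
def CanInduce {α : Type*} [MeasurableSpace α] (p : PMF α) (σ ρ : ℝ) : Prop :=
  ∀ δ : ℝ, 0 < δ → ∃ f : Jammer α,
    AveragePowerLE p ρ f ∧
    CodebookRateLE (1 / 2 * Real.logb 2 (1 + ρ / σ ^ 2) + δ) f ∧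
    InducesGaussianNoise p σ ρ f

end CoopJam

end

noncomputable section

namespace CoopJam

open scoped ENNReal NNReal

/-! In natural units let `C = ½ log ((σ² + ρ) / σ²)` and let `H` be the source entropy. Then `ρ ≤
ρ*` means `C ≤ H`, so the theorem says that `C` nats of randomness per symbol are necessary and,
apart from the boundary case, sufficient. It suffices to treat the codeword `0`, because the channel
commutes with translations.

Both halves compare `N(c, σ²I)` with `N(0, (σ² + ρ)I)` by the explicit density `gaussianRatio`. Its
logarithm is `nC` plus a difference of two squared norms, each close to `n/2` by the law of large
numbers, hence close to `nC` on typical pairs.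

Converse (`half_log_le_of_inducesGaussianNoise`): up to small probability the interference takes at
most `exp (n (H + δ))` values, and the observation lies in a ball of squared radius about `nσ²`
around one of them. Apart from one unlikely event, each ball has mass at most `exp (-n (C - δ))`
under the wider Gaussian. If `H < C`, the union of the balls is an event that tells the two laws
apart.

Achievability (`eventually_exists_admissible`): if `C < H`, typical source sequences are such small
atoms that they can be grouped into about `exp (n (C + 2d))` bins of nearly equal mass. Each bin
gets an independent `N(0, ρI)` codeword. A second-moment form of soft covering (`exists_codebook`,
`mul_setIntegral_sub_le`) shows that the mixture of the shifted noises dominates Gaussian noise up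
to a small error on every event. The bins carry total mass below one, and this slack lets the same
averaging enforce the power constraint exactly. -/

/-! ### Law of large numbers, product densities and Gaussian change of measure -/

/-- Weak law of large numbers for finite product measures. -/
theorem tendsto_pi_real_abs_sum_sub {E : Type*} [MeasurableSpace E] (μ : Measure E)
    [IsProbabilityMeasure μ] {g : E → ℝ} (hgm : Measurable g) (hg : Integrable g μ)
    {δ : ℝ} (hδ : 0 < δ) :
    Tendsto (fun n : ℕ => (Measure.pi fun _ : Fin n => μ).real
      {x | n * δ ≤ |∑ i, g (x i) - n * ∫ e, g e ∂μ|}) atTop (𝓝 0) := by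
  -- The strong law concerns one infinite sequence, so all block lengths are realised as its initial
  -- segments; `hmap` below identifies their laws.
  let P : Measure (ℕ → E) := Measure.infinitePi fun _ => μ
  let X : ℕ → (ℕ → E) → ℝ := fun i ω => g (ω i)
  have hmp : ∀ i, MeasurePreserving (fun ω : ℕ → E => ω i) P μ := fun i =>
    measurePreserving_eval_infinitePi (fun _ => μ) i
  have hXm : ∀ i, Measurable (X i) := fun i => hgm.comp (measurable_pi_apply i)
  have hint : ∫ ω, X 0 ω ∂P = ∫ e, g e ∂μ := by
    rw [← (hmp 0).map_eq, integral_map (measurable_pi_apply 0).aemeasurable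
      hgm.aestronglyMeasurable]
  have hslln : ∀ᵐ ω ∂P, Tendsto (fun n : ℕ => (∑ i ∈ Finset.range n, X i ω) / n) atTop
      (𝓝 (∫ e, g e ∂μ)) := by
    rw [← hint]
    refine strong_law_ae_real X ((hmp 0).integrable_comp_of_integrable hg) ?_ ?_
    · intro i j hij
      exact (iIndepFun_infinitePi (P := fun _ : ℕ => μ) (X := fun _ => g)
        (fun _ => hgm)).indepFun hij
    · intro i
      refine ⟨(hXm i).aemeasurable, (hXm 0).aemeasurable, ?_⟩
      have h : ∀ i, P.map (X i) = μ.map g := fun i => by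
        rw [← (hmp i).map_eq, Measure.map_map hgm (measurable_pi_apply i)]; rfl
      rw [h, h]
  have hmeas := tendstoInMeasure_of_tendsto_ae (f := fun (n : ℕ) ω =>
    (∑ i ∈ Finset.range n, X i ω) / n) (fun n =>
      ((Finset.measurable_sum _ fun i _ => hXm i).div_const _).aestronglyMeasurable) hslln
  rw [tendstoInMeasure_iff_dist] at hmeas
  have h1 := (ENNReal.tendsto_toReal ENNReal.zero_ne_top).comp (hmeas δ hδ)
  simp only [ENNReal.toReal_zero] at h1
  refine h1.congr' ?_
  filter_upwards [eventually_gt_atTop 0] with n hn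
  have hmap : P.map (fun ω (i : Fin n) => ω i) = Measure.pi fun _ : Fin n => μ := by
    symm
    refine Measure.pi_eq fun s hs => ?_
    have hm : Measurable (fun (ω : ℕ → E) (i : Fin n) => ω i) :=
      measurable_pi_lambda _ fun i => measurable_pi_apply _
    rw [Measure.map_apply hm (MeasurableSet.univ_pi hs)]
    have hset : (fun (ω : ℕ → E) (i : Fin n) => ω i) ⁻¹' (Set.univ.pi s) =
        Set.pi ((Finset.range n : Finset ℕ) : Set ℕ)
          (fun i => if h : i < n then s ⟨i, h⟩ else Set.univ) := by
      ext ω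
      simp only [Set.mem_preimage, Set.mem_pi, Set.mem_univ, true_imp_iff, Finset.coe_range,
        Set.mem_Iio]
      constructor
      · intro h i hi
        simpa [hi] using h ⟨i, hi⟩
      · intro h i
        simpa using h i i.2
    rw [hset, Measure.infinitePi_pi]
    · rw [Finset.prod_range]
      simp
    · intro i hi
      simp only [Finset.mem_range] at hi
      simpa [hi] using hs _
  have hset : MeasurableSet {x : Fin n → E | n * δ ≤ |∑ i, g (x i) - n * ∫ e, g e ∂μ|} := by
    have : Measurable fun x : Fin n → E => |∑ i, g (x i) - n * ∫ e, g e ∂μ| := by fun_prop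
    exact measurableSet_le measurable_const this
  rw [Function.comp_apply, Measure.real, ← hmap, Measure.map_apply (by fun_prop) hset]
  congr 2
  ext ω
  have hn' : (0 : ℝ) < n := by exact_mod_cast hn
  have h2 : (∑ i : Fin n, g (ω i)) - n * ∫ e, g e ∂μ =
      n * ((∑ i : Fin n, g (ω i)) / n - ∫ e, g e ∂μ) := by field_simp
  simp only [X, Set.mem_ofPred_eq, Set.mem_preimage, Real.dist_eq]
  rw [Finset.sum_range, h2, abs_mul, abs_of_pos hn', mul_le_mul_iff_right₀ hn']

/-- A finite product of measures with densities has the product density. -/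
theorem pi_withDensity {ι : Type*} [Fintype ι] {E : ι → Type*} [∀ i, MeasurableSpace (E i)]
    (μ : ∀ i, Measure (E i)) [∀ i, IsProbabilityMeasure (μ i)] {f : ∀ i, E i → ℝ≥0∞}
    (hf : ∀ i, Measurable (f i)) [∀ i, SigmaFinite ((μ i).withDensity (f i))] :
    Measure.pi (fun i => (μ i).withDensity (f i)) =
      (Measure.pi μ).withDensity fun x => ∏ i, f i (x i) := by
  refine Measure.pi_eq fun s hs => ?_
  rw [withDensity_apply _ (MeasurableSet.univ_pi hs),
    ← lintegral_indicator (MeasurableSet.univ_pi hs)]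
  have h : ∀ x, (Set.univ.pi s).indicator (fun x => ∏ i, f i (x i)) x =
      ∏ i, (s i).indicator (f i) (x i) := by
    intro x
    by_cases hx : x ∈ Set.univ.pi s
    · rw [Set.indicator_of_mem hx]
      exact Finset.prod_congr rfl fun i _ =>
        (Set.indicator_of_mem (hx i (Set.mem_univ i)) _).symm
    · rw [Set.indicator_of_notMem hx]
      simp only [Set.mem_pi, Set.mem_univ, true_imp_iff, not_forall] at hx
      obtain ⟨i, hi⟩ := hx
      exact (Finset.prod_eq_zero (Finset.mem_univ i) (Set.indicator_of_notMem hi _)).symm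
  simp_rw [h]
  rw [lintegral_prod_eq_prod_lintegral_of_indepFun Finset.univ
    (fun i (x : ∀ i, E i) => (s i).indicator (f i) (x i))
    (iIndepFun_pi fun i => ((hf i).indicator (hs i)).aemeasurable)
    (fun i => ((hf i).indicator (hs i)).comp (measurable_pi_apply i))]
  refine Finset.prod_congr rfl fun i _ => ?_
  rw [withDensity_apply _ (hs i), ← lintegral_indicator (hs i),
    ← (measurePreserving_eval μ i).map_eq,
    lintegral_map ((hf i).indicator (hs i)) (measurable_pi_apply i)]

/-- The density at `z` of the law of `c` plus Gaussian noise of variance `s`, relative to the law of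
centered Gaussian noise of variance `v`. -/
def gaussianRatio (v s : ℝ) {n : ℕ} (c z : Fin n → ℝ) : ℝ :=
  √(v / s) ^ n * Real.exp ((∑ i, z i ^ 2) / (2 * v) - (∑ i, (z i - c i) ^ 2) / (2 * s))

theorem gaussianRatio_nonneg (v s : ℝ) {n : ℕ} (c z : Fin n → ℝ) : 0 ≤ gaussianRatio v s c z := by
  unfold gaussianRatio; positivity

theorem measurable_gaussianRatio (v s : ℝ) (n : ℕ) :
    Measurable (Function.uncurry (gaussianRatio v s : (Fin n → ℝ) → (Fin n → ℝ) → ℝ)) := by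
  unfold gaussianRatio Function.uncurry; fun_prop

instance (v : ℝ) (n : ℕ) : IsProbabilityMeasure (noiseLaw v n) := by
  unfold noiseLaw; infer_instance

instance (v : ℝ) (n : ℕ) (x : Fin n → ℝ) : IsProbabilityMeasure (awgnLaw v n x) :=
  Measure.isProbabilityMeasure_map (by fun_prop)

theorem gaussianReal_eq_withDensity {v s : ℝ} (hv : 0 < v) (hs : 0 < s) (c : ℝ) :
    gaussianReal c s.toNNReal = (gaussianReal 0 v.toNNReal).withDensity fun z =>
      ENNReal.ofReal (√(v / s) * Real.exp (z ^ 2 / (2 * v) - (z - c) ^ 2 / (2 * s))) := by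
  rw [gaussianReal_of_var_ne_zero _ (Real.toNNReal_pos.2 hs).ne',
    gaussianReal_of_var_ne_zero _ (Real.toNNReal_pos.2 hv).ne',
    ← withDensity_mul _ (measurable_gaussianPDF _ _) (by fun_prop)]
  congr 1
  ext z
  rw [Pi.mul_apply, gaussianPDF, gaussianPDF, ← ENNReal.ofReal_mul (gaussianPDFReal_nonneg _ _ _)]
  congr 1
  have hsqrt : (√(2 * Real.pi * v))⁻¹ * √(v / s) = (√(2 * Real.pi * s))⁻¹ := by
    rw [← Real.sqrt_inv, ← Real.sqrt_inv, ← Real.sqrt_mul (by positivity)]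
    congr 1
    field_simp
  simp only [gaussianPDFReal, Real.coe_toNNReal _ hv.le, Real.coe_toNNReal _ hs.le]
  rw [mul_mul_mul_comm, hsqrt, ← Real.exp_add]
  congr 2
  ring

theorem awgnLaw_eq_pi (v : ℝ) (n : ℕ) (x : Fin n → ℝ) :
    awgnLaw v n x = Measure.pi fun i => gaussianReal (x i) v.toNNReal := by
  have h : ∀ i, (gaussianReal 0 v.toNNReal).map (fun w => x i + w) =
      gaussianReal (x i) v.toNNReal := fun i => by
    rw [gaussianReal_map_const_add, zero_add]
  simp_rw [← h]
  have : ∀ i, SigmaFinite ((gaussianReal 0 v.toNNReal).map fun w => x i + w) := fun i => by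
    rw [h]; infer_instance
  rw [← Measure.pi_map_pi (fun i => by fun_prop)]
  rfl

/-- The reference measure is the target law, and the density depends on `z` only through two squared
norms, which the law of large numbers controls. -/
theorem awgnLaw_eq_withDensity {v s : ℝ} (hv : 0 < v) (hs : 0 < s) (n : ℕ) (c : Fin n → ℝ) :
    awgnLaw s n c =
      (noiseLaw v n).withDensity fun z => ENNReal.ofReal (gaussianRatio v s c z) := by
  have hd : ∀ i, SigmaFinite ((gaussianReal 0 v.toNNReal).withDensity fun z =>
      ENNReal.ofReal (√(v / s) * Real.exp (z ^ 2 / (2 * v) - (z - c i) ^ 2 / (2 * s)))) :=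
    fun i => by rw [← gaussianReal_eq_withDensity hv hs]; infer_instance
  rw [awgnLaw_eq_pi]
  simp_rw [gaussianReal_eq_withDensity hv hs]
  rw [pi_withDensity (fun _ : Fin n => gaussianReal 0 v.toNNReal) (fun i => by fun_prop)]
  unfold noiseLaw
  congr 1
  ext z
  rw [← ENNReal.ofReal_prod_of_nonneg fun i _ => by positivity]
  congr 1
  rw [Finset.prod_mul_distrib, ← Real.exp_sum, Finset.prod_const, Finset.card_univ,
    Fintype.card_fin, Finset.sum_sub_distrib, gaussianRatio, Finset.sum_div, Finset.sum_div]

theorem integrable_sq_gaussianReal (v : ℝ≥0) : Integrable (fun x : ℝ => x ^ 2) (gaussianReal 0 v) :=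
  (memLp_id_gaussianReal 2).integrable_sq

theorem integral_sq_gaussianReal (v : ℝ≥0) : ∫ x, x ^ 2 ∂gaussianReal 0 v = v := by
  have h := variance_fun_id_gaussianReal (μ := 0) (v := v)
  rw [variance_eq_integral (by fun_prop)] at h
  simpa using h

/-- The squared norm of white Gaussian noise of variance `v` concentrates around `n * v`. -/
theorem tendsto_noiseLaw_real_abs_sum_sq_sub {v : ℝ} (hv : 0 ≤ v) {δ : ℝ} (hδ : 0 < δ) :
    Tendsto (fun n : ℕ => (noiseLaw v n).real {z | n * δ ≤ |∑ i, z i ^ 2 - n * v|})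
      atTop (𝓝 0) := by
  have h := tendsto_pi_real_abs_sum_sub (gaussianReal 0 v.toNNReal) (g := fun x => x ^ 2)
    (by fun_prop) (integrable_sq_gaussianReal _) hδ
  simp only [integral_sq_gaussianReal, Real.coe_toNNReal _ hv] at h
  exact h

/-- Independent white Gaussian noises add up to white Gaussian noise. -/
theorem noiseLaw_prod_map_add {u v : ℝ} (hu : 0 ≤ u) (hv : 0 ≤ v) (n : ℕ) :
    ((noiseLaw u n).prod (noiseLaw v n)).map (fun q => q.1 + q.2) = noiseLaw (u + v) n := by
  have h := measurePreserving_arrowProdEquivProdArrow ℝ ℝ (Fin n)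
    (fun _ => gaussianReal 0 u.toNNReal) (fun _ => gaussianReal 0 v.toNNReal)
  unfold noiseLaw
  rw [← h.map_eq, Measure.map_map (by fun_prop) h.measurable]
  have hconv : ((gaussianReal 0 u.toNNReal).prod (gaussianReal 0 v.toNNReal)).map
      (fun q : ℝ × ℝ => q.1 + q.2) = gaussianReal 0 (u + v).toNNReal := by
    rw [Real.toNNReal_add hu hv]
    simpa [Measure.conv] using gaussianReal_conv_gaussianReal (m₁ := 0) (m₂ := 0)
      (v₁ := u.toNNReal) (v₂ := v.toNNReal)
  have : SigmaFinite (((gaussianReal 0 u.toNNReal).prod (gaussianReal 0 v.toNNReal)).map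
      (fun q : ℝ × ℝ => q.1 + q.2)) := by rw [hconv]; infer_instance
  simp_rw [← hconv]
  rw [← Measure.pi_map_pi (fun i => by fun_prop)]
  rfl

/-! ### Variational distance, the jammed channel and typical source sequences -/

section

/-- Without boundedness the real supremum in `varDist` would take its default value `0`. -/
theorem bddAbove_range_abs_real_sub {Ω : Type*} [MeasurableSpace Ω] (μ ν : Measure Ω)
    [IsProbabilityMeasure μ] [IsProbabilityMeasure ν] :
    BddAbove (Set.range fun s : {s : Set Ω // MeasurableSet s} => |μ.real s.1 - ν.real s.1|) := by
  refine ⟨1, ?_⟩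
  rintro _ ⟨s, rfl⟩
  have h1 : μ.real s.1 ≤ 1 := measureReal_le_one
  have h2 : ν.real s.1 ≤ 1 := measureReal_le_one
  have h3 : 0 ≤ μ.real s.1 := measureReal_nonneg
  have h4 : 0 ≤ ν.real s.1 := measureReal_nonneg
  exact abs_le.2 ⟨by linarith, by linarith⟩

theorem two_mul_abs_sub_le_varDist {Ω : Type*} [MeasurableSpace Ω] (μ ν : Measure Ω)
    [IsProbabilityMeasure μ] [IsProbabilityMeasure ν] {s : Set Ω} (hs : MeasurableSet s) :
    2 * |μ.real s - ν.real s| ≤ varDist μ ν :=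
  mul_le_mul_of_nonneg_left (le_ciSup (bddAbove_range_abs_real_sub μ ν) ⟨s, hs⟩) zero_le_two

/-- Passing to complements, a one-sided comparison on all events bounds the variational
distance. -/
theorem varDist_le_of_forall_le_add {Ω : Type*} [MeasurableSpace Ω] {μ ν : Measure Ω}
    [IsProbabilityMeasure μ] [IsProbabilityMeasure ν] {ε : ℝ}
    (h : ∀ s, MeasurableSet s → ν.real s ≤ μ.real s + ε) : varDist μ ν ≤ 2 * ε := by
  have : Nonempty {s : Set Ω // MeasurableSet s} := ⟨⟨∅, MeasurableSet.empty⟩⟩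
  refine mul_le_mul_of_nonneg_left (ciSup_le fun s => ?_) zero_le_two
  have h1 := h s.1 s.2
  have h2 := h s.1ᶜ s.2.compl
  rw [measureReal_compl s.2, measureReal_compl s.2, probReal_univ, probReal_univ] at h2
  exact abs_le.2 ⟨by linarith, by linarith⟩

theorem awgnLaw_zero (v : ℝ) (n : ℕ) : awgnLaw v n 0 = noiseLaw v n := by
  simp [awgnLaw]

theorem integral_sum_sq_noiseLaw {v : ℝ} (hv : 0 ≤ v) (n : ℕ) :
    Integrable (fun z : Fin n → ℝ => ∑ i, z i ^ 2) (noiseLaw v n) ∧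
      ∫ z, ∑ i, z i ^ 2 ∂noiseLaw v n = n * v := by
  have hi : ∀ i : Fin n, Integrable (fun z : Fin n → ℝ => z i ^ 2) (noiseLaw v n) := fun i =>
    integrable_comp_eval (μ := fun _ : Fin n => gaussianReal 0 v.toNNReal) (i := i)
      (integrable_sq_gaussianReal v.toNNReal)
  refine ⟨integrable_finsetSum _ fun i _ => hi i, ?_⟩
  rw [integral_finsetSum _ fun i _ => hi i]
  have : ∀ i : Fin n, ∫ z, z i ^ 2 ∂noiseLaw v n = v := fun i => by
    have h := integral_comp_eval (μ := fun _ : Fin n => gaussianReal 0 v.toNNReal) (i := i)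
      (f := fun x => x ^ 2) (integrable_sq_gaussianReal v.toNNReal).aestronglyMeasurable
    rw [integral_sq_gaussianReal, Real.coe_toNNReal _ hv] at h
    exact h
  simp [this]

variable {α : Type*} [MeasurableSpace α]

instance (p : PMF α) (n : ℕ) : IsProbabilityMeasure (sourceLaw p n) := by
  unfold sourceLaw; infer_instance

variable [MeasurableSingletonClass α]

theorem measurable_jammedLaw_aux [Countable α] (f : Jammer α) (n : ℕ) (x : Fin n → ℝ) :
    Measurable fun q : (Fin n → α) × (Fin n → ℝ) => x + f n q.1 + q.2 := by
  have hf : Measurable (f n) := measurable_of_countable _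
  fun_prop

instance [Countable α] (p : PMF α) (σ : ℝ) (f : Jammer α) (n : ℕ) (x : Fin n → ℝ) :
    IsProbabilityMeasure (jammedLaw p σ f n x) :=
  Measure.isProbabilityMeasure_map (measurable_jammedLaw_aux f n x).aemeasurable

/-- Conditioning on the source turns the observation into a mixture of shifted Gaussian noises. -/
theorem jammedLaw_apply [Countable α] (p : PMF α) (σ : ℝ) (f : Jammer α) (n : ℕ) (x : Fin n → ℝ)
    {s : Set (Fin n → ℝ)} (hs : MeasurableSet s) :
    jammedLaw p σ f n x s = ∫⁻ r, awgnLaw (σ ^ 2) n (x + f n r) s ∂sourceLaw p n := by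
  have hm := measurable_jammedLaw_aux f n x
  rw [jammedLaw, Measure.map_apply hm hs, Measure.prod_apply (hm hs)]
  refine lintegral_congr fun r => ?_
  rw [awgnLaw, Measure.map_apply (by fun_prop) hs]
  rfl

theorem jammedLaw_eq_map [Countable α] (p : PMF α) (σ : ℝ) (f : Jammer α) (n : ℕ) (x : Fin n → ℝ) :
    jammedLaw p σ f n x = (jammedLaw p σ f n 0).map fun w => x + w := by
  rw [jammedLaw, jammedLaw, Measure.map_map (by fun_prop) (measurable_jammedLaw_aux f n 0)]
  congr 1
  ext q i
  simp [add_assoc]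

/-- The channel commutes with translations, so it is enough to look at the codeword `0`. -/
theorem varDist_jammedLaw_le [Countable α] {p : PMF α} {σ v ε : ℝ} {f : Jammer α} {n : ℕ}
    (h : ∀ s, MeasurableSet s → (noiseLaw v n).real s ≤ (jammedLaw p σ f n 0).real s + ε)
    (x : Fin n → ℝ) : varDist (jammedLaw p σ f n x) (awgnLaw v n x) ≤ 2 * ε := by
  refine varDist_le_of_forall_le_add fun s hs => ?_
  have hm : Measurable fun w : Fin n → ℝ => x + w := by fun_prop
  rw [jammedLaw_eq_map, awgnLaw, map_measureReal_apply hm hs, map_measureReal_apply hm hs]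
  exact h _ (hm hs)

theorem integrable_neg_log_toMeasure [Countable α] {p : PMF α}
    (hp : Summable fun a => Real.negMulLog (p a).toReal) :
    Integrable (fun a => -Real.log (p a).toReal) p.toMeasure := by
  refine ⟨(measurable_of_countable _).aestronglyMeasurable, ?_⟩
  have h0 : ∀ a, 0 ≤ Real.negMulLog (p a).toReal := fun a =>
    Real.negMulLog_nonneg ENNReal.toReal_nonneg
      (ENNReal.toReal_mono ENNReal.one_ne_top (p.coe_le_one a))
  rw [HasFiniteIntegral, lintegral_countable']
  have : ∀ a, ‖-Real.log (p a).toReal‖ₑ * p.toMeasure {a} =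
      ENNReal.ofReal (Real.negMulLog (p a).toReal) := fun a => by
    have hl : 0 ≤ -Real.log (p a).toReal := by
      simpa using Real.log_nonpos ENNReal.toReal_nonneg
        (ENNReal.toReal_mono ENNReal.one_ne_top (p.coe_le_one a))
    rw [PMF.toMeasure_apply_singleton _ _ (measurableSet_singleton a), Real.enorm_of_nonneg hl]
    nth_rw 2 [← ENNReal.ofReal_toReal (p.apply_ne_top a)]
    rw [← ENNReal.ofReal_mul hl, Real.negMulLog]
    congr 1
    ring
  simp_rw [this]
  rw [← ENNReal.ofReal_tsum_of_nonneg h0 hp]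
  exact ENNReal.ofReal_lt_top

theorem integral_neg_log_toMeasure [Countable α] {p : PMF α}
    (hp : Summable fun a => Real.negMulLog (p a).toReal) :
    ∫ a, -Real.log (p a).toReal ∂p.toMeasure = ∑' a, Real.negMulLog (p a).toReal := by
  rw [PMF.integral_eq_tsum p _ (integrable_neg_log_toMeasure hp)]
  refine tsum_congr fun a => ?_
  rw [smul_eq_mul, Real.negMulLog]
  ring

theorem sourceLaw_real_singleton (p : PMF α) (n : ℕ) (r : Fin n → α) :
    (sourceLaw p n).real {r} = ∏ i, (p (r i)).toReal := by
  rw [Measure.real, sourceLaw, Measure.pi_singleton, ENNReal.toReal_prod]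
  refine Finset.prod_congr rfl fun i _ => ?_
  rw [PMF.toMeasure_apply_singleton _ _ (measurableSet_singleton _)]

/-- The source sequences whose probability is `exp (-n (h ± δ))`. -/
def typicalSet (p : PMF α) (h δ : ℝ) (n : ℕ) : Set (Fin n → α) :=
  {r | Real.exp (-(n * (h + δ))) ≤ (sourceLaw p n).real {r} ∧
    (sourceLaw p n).real {r} ≤ Real.exp (-(n * (h - δ)))}

/-- Each typical sequence has mass at least `exp (-(n (h + δ)))`, and the masses sum to at most one.
-/
theorem card_le_of_subset_typicalSet {p : PMF α} {h δ : ℝ} {n : ℕ} (T : Finset (Fin n → α))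
    (hT : (T : Set (Fin n → α)) ⊆ typicalSet p h δ n) : (T.card : ℝ) ≤ Real.exp (n * (h + δ)) := by
  have h1 : ∑ r ∈ T, (sourceLaw p n).real {r} ≤ 1 := by
    rw [sum_measureReal_singleton]
    exact measureReal_le_one
  have h2 : T.card • Real.exp (-(n * (h + δ))) ≤ ∑ r ∈ T, (sourceLaw p n).real {r} :=
    Finset.card_nsmul_le_sum _ _ _ fun r hr => (hT hr).1
  rw [nsmul_eq_mul, Real.exp_neg, ← div_eq_mul_inv] at h2
  exact (div_le_one (Real.exp_pos _)).1 (h2.trans h1)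

/-- The alphabet may be infinite; an infinite typical set would have finite subsets violating the
cardinality bound. -/
theorem finite_typicalSet (p : PMF α) (h δ : ℝ) (n : ℕ) : (typicalSet p h δ n).Finite := by
  by_contra hinf
  obtain ⟨T, hT, hcard⟩ := Set.Infinite.exists_subset_card_eq hinf
    (⌊Real.exp (n * (h + δ))⌋₊ + 1)
  have h1 := card_le_of_subset_typicalSet T hT
  rw [hcard] at h1
  have h2 := Nat.lt_floor_add_one (Real.exp (n * (h + δ)))
  push_cast at h1
  linarith

theorem tendsto_sourceLaw_real_compl_typicalSet [Countable α] {p : PMF α}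
    (hp : Summable fun a => Real.negMulLog (p a).toReal) {δ : ℝ} (hδ : 0 < δ) :
    Tendsto (fun n : ℕ => (sourceLaw p n).real
      (typicalSet p (∑' a, Real.negMulLog (p a).toReal) δ n)ᶜ) atTop (𝓝 0) := by
  have hw := tendsto_pi_real_abs_sum_sub p.toMeasure (g := fun a => -Real.log (p a).toReal)
    (measurable_of_countable _) (integrable_neg_log_toMeasure hp) hδ
  rw [integral_neg_log_toMeasure hp] at hw
  refine squeeze_zero (fun _ => measureReal_nonneg) (fun n => ?_) hw
  set h := ∑' a, Real.negMulLog (p a).toReal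
  -- `Real.log 0 = 0` breaks the logarithm of the product on sequences of probability zero. They are
  -- countably many, so together they are null.
  have hnull : ∀ᵐ r ∂sourceLaw p n, (sourceLaw p n) {r} ≠ 0 := by
    rw [ae_iff, ← Set.biUnion_of_singleton {r | ¬ (sourceLaw p n) {r} ≠ 0}]
    exact (measure_biUnion_null_iff (Set.to_countable _)).2 fun r hr => by simpa using hr
  refine ENNReal.toReal_mono (measure_ne_top _ _) (measure_mono_ae ?_)
  filter_upwards [hnull] with r hr hrT
  have hpos : 0 < (sourceLaw p n).real {r} := ENNReal.toReal_pos hr (measure_ne_top _ _)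
  have hlog : Real.log ((sourceLaw p n).real {r}) = -∑ i, -Real.log (p (r i)).toReal := by
    rw [sourceLaw_real_singleton] at hpos ⊢
    rw [Real.log_prod fun i hi => Finset.prod_ne_zero_iff.1 hpos.ne' i hi]
    simp
  by_contra hlt
  apply hrT
  have hlt' : |∑ i, -Real.log (p (r i)).toReal - n * h| < n * δ := not_le.1 hlt
  rw [abs_lt] at hlt'
  refine ⟨(Real.le_log_iff_exp_le hpos).1 ?_, (Real.log_le_iff_le_exp hpos).1 ?_⟩ <;>
    rw [hlog] <;> linarith

end

/-! ### Converse: few noise balls cannot carry the wider Gaussian -/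

section

theorem sqrt_pow_eq_exp {x : ℝ} (hx : 0 < x) (n : ℕ) :
    √x ^ n = Real.exp (n * (1 / 2 * Real.log x)) := by
  rw [Real.exp_nat_mul, Real.sqrt_eq_rpow, Real.rpow_def_of_pos hx, mul_comm]

/-- Markov's inequality for a likelihood ratio: its integral over `A` is a probability under the
shifted Gaussian, hence at most one. -/
theorem noiseLaw_real_le_inv {v s L : ℝ} (hv : 0 < v) (hs : 0 < s) (hL : 0 < L) {n : ℕ}
    {c : Fin n → ℝ} {A : Set (Fin n → ℝ)} (hA : MeasurableSet A)
    (h : ∀ z ∈ A, L ≤ gaussianRatio v s c z) : (noiseLaw v n).real A ≤ L⁻¹ := by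
  have h1 : ENNReal.ofReal L * noiseLaw v n A ≤ 1 :=
    calc ENNReal.ofReal L * noiseLaw v n A = ∫⁻ _ in A, ENNReal.ofReal L ∂noiseLaw v n := by simp
      _ ≤ ∫⁻ z in A, ENNReal.ofReal (gaussianRatio v s c z) ∂noiseLaw v n :=
        setLIntegral_mono' hA fun z hz => ENNReal.ofReal_le_ofReal (h z hz)
      _ = awgnLaw s n c A := by rw [awgnLaw_eq_withDensity hv hs, withDensity_apply _ hA]
      _ ≤ 1 := prob_le_one
  have h2 := ENNReal.toReal_mono ENNReal.one_ne_top h1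
  rw [ENNReal.toReal_mul, ENNReal.toReal_ofReal hL.le, ENNReal.toReal_one] at h2
  rw [← one_div, le_div_iff₀' hL]
  exact h2

/-- The sequences at squared distance less than `a` from `c`. -/
def sqBall {n : ℕ} (c : Fin n → ℝ) (a : ℝ) : Set (Fin n → ℝ) := {z | ∑ i, (z i - c i) ^ 2 < a}

theorem measurableSet_sqBall {n : ℕ} (c : Fin n → ℝ) (a : ℝ) : MeasurableSet (sqBall c a) :=
  measurableSet_lt (by fun_prop) measurable_const

theorem awgnLaw_sqBall (s : ℝ) {n : ℕ} (c : Fin n → ℝ) (a : ℝ) :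
    awgnLaw s n c (sqBall c a) = noiseLaw s n {w | ∑ i, w i ^ 2 < a} := by
  rw [awgnLaw, Measure.map_apply (by fun_prop) (measurableSet_sqBall c a)]
  simp [sqBall]

variable {α : Type*} [MeasurableSpace α] [MeasurableSingletonClass α] [Countable α]

/-- The interference cannot miss the neighbourhoods of the codewords of a set of source sequences
by more than the source misses that set and the noise misses a ball. -/
theorem mul_le_jammedLaw_real_biUnion_sqBall (p : PMF α) (σ : ℝ) (f : Jammer α) (n : ℕ)
    (T : Finset (Fin n → α)) (a : ℝ) :
    (sourceLaw p n).real T * (noiseLaw (σ ^ 2) n).real {w | ∑ i, w i ^ 2 < a} ≤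
      (jammedLaw p σ f n 0).real (⋃ r ∈ T, sqBall (f n r) a) := by
  have hS : MeasurableSet (⋃ r ∈ T, sqBall (f n r) a) :=
    Finset.measurableSet_biUnion _ fun r _ => measurableSet_sqBall _ _
  rw [Measure.real, Measure.real, ← ENNReal.toReal_mul]
  refine ENNReal.toReal_mono (measure_ne_top _ _) ?_
  rw [jammedLaw_apply p σ f n 0 hS, mul_comm, ← setLIntegral_const]
  refine (setLIntegral_mono' (Set.to_countable _).measurableSet fun r hr => ?_).trans
    (setLIntegral_le_lintegral _ _)
  rw [zero_add, ← awgnLaw_sqBall _ (f n r)]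
  exact measure_mono (Set.subset_biUnion_of_mem (u := fun r => sqBall (f n r) a) hr)

/-- White Gaussian noise hardly meets the neighbourhoods of few sequences. -/
theorem noiseLaw_real_biUnion_sqBall_le {β : Type*} {v s δ : ℝ} (hv : 0 < v) (hs : 0 < s) {n : ℕ}
    (T : Finset β) (c : β → Fin n → ℝ) :
    (noiseLaw v n).real (⋃ r ∈ T, sqBall (c r) (n * (s + δ * s))) ≤
      (noiseLaw v n).real {z | ∑ i, z i ^ 2 ≤ n * (v - δ * v)} +
        T.card * Real.exp (-(n * (1 / 2 * Real.log (v / s) - δ))) := by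
  -- On short `z` the ratio may be too small. Removing `D` from all the balls together means that
  -- its mass is paid only once.
  set D : Set (Fin n → ℝ) := {z | ∑ i, z i ^ 2 ≤ n * (v - δ * v)}
  have hD : MeasurableSet D := measurableSet_le (by fun_prop) measurable_const
  have hsub : (⋃ r ∈ T, sqBall (c r) (n * (s + δ * s))) ⊆
      D ∪ ⋃ r ∈ T, (sqBall (c r) (n * (s + δ * s)) \ D) := by
    intro z hz
    by_cases hzD : z ∈ D
    · exact Or.inl hzD
    · simp only [Set.mem_iUnion, exists_prop] at hz
      obtain ⟨r, hr, hz⟩ := hz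
      exact Or.inr (Set.mem_biUnion hr ⟨hz, hzD⟩)
  refine (measureReal_mono hsub).trans ((measureReal_union_le _ _).trans ?_)
  gcongr
  refine (measureReal_biUnion_finset_le _ _).trans ?_
  refine (Finset.sum_le_sum (g := fun _ => Real.exp (-(n * (1 / 2 * Real.log (v / s) - δ))))
    fun r _ => ?_).trans_eq (by simp)
  rw [Real.exp_neg]
  refine noiseLaw_real_le_inv (c := c r) hv hs (Real.exp_pos _)
    ((measurableSet_sqBall _ _).diff hD) fun z hz => ?_
  have h1 : ∑ i, (z i - c r i) ^ 2 < n * (s + δ * s) := hz.1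
  have h2 : n * (v - δ * v) < ∑ i, z i ^ 2 := not_le.1 hz.2
  rw [gaussianRatio, sqrt_pow_eq_exp (div_pos hv hs), ← Real.exp_add, Real.exp_le_exp]
  -- The terms `n/2` of the two quadratic forms cancel, and the tolerances leave a loss of `nδ`.
  have h3 : (∑ i, (z i - c r i) ^ 2) / (2 * s) ≤ n * (1 + δ) / 2 := by
    rw [div_le_div_iff₀ (by positivity) two_pos]; nlinarith
  have h4 : n * (1 - δ) / 2 ≤ (∑ i, z i ^ 2) / (2 * v) := by
    rw [div_le_div_iff₀ two_pos (by positivity)]; nlinarith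
  linarith

/-- The source must supply the randomness of the induced noise. -/
theorem half_log_le_of_inducesGaussianNoise {p : PMF α}
    (hp : Summable fun a => Real.negMulLog (p a).toReal) {σ ρ : ℝ} (hσ : 0 < σ) (hρ : 0 ≤ ρ)
    {f : Jammer α} (hf : InducesGaussianNoise p σ ρ f) :
    1 / 2 * Real.log ((σ ^ 2 + ρ) / σ ^ 2) ≤ ∑' a, Real.negMulLog (p a).toReal := by
  by_contra! hlt
  have hs : 0 < σ ^ 2 := by positivity
  have hv : 0 < σ ^ 2 + ρ := by positivity
  set s := σ ^ 2
  set v := s + ρ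
  set H := ∑' a, Real.negMulLog (p a).toReal
  set C := 1 / 2 * Real.log (v / s)
  -- One `δ` goes to the count of typical sequences and one to the mass of a ball, so the union
  -- bound has exponent `-2δ`.
  obtain ⟨δ, hδ, hCδ⟩ : ∃ δ, 0 < δ ∧ C = H + 4 * δ := ⟨(C - H) / 4, by linarith, by ring⟩
  have hexp : Tendsto (fun n : ℕ => Real.exp (-(n * (2 * δ)))) atTop (𝓝 0) :=
    Real.tendsto_exp_neg_atTop_nhds_zero.comp
      (tendsto_natCast_atTop_atTop.atTop_mul_const (by positivity))
  have hev : ∀ᶠ n : ℕ in atTop, False := by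
    -- Distance at most `1` means that event probabilities differ by at most `1/2`. The
    -- contradiction is `(15/16)² > 1/2 + 1/16 + 1/16`.
    filter_upwards [hf 1 one_pos,
      (tendsto_sourceLaw_real_compl_typicalSet hp hδ).eventually_le_const
        (show (0 : ℝ) < 1 / 16 by norm_num),
      (tendsto_noiseLaw_real_abs_sum_sq_sub hs.le (mul_pos hδ hs)).eventually_le_const
        (show (0 : ℝ) < 1 / 16 by norm_num),
      (tendsto_noiseLaw_real_abs_sum_sq_sub hv.le (mul_pos hδ hv)).eventually_le_const
        (show (0 : ℝ) < 1 / 16 by norm_num),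
      hexp.eventually_le_const (show (0 : ℝ) < 1 / 16 by norm_num)] with n h1 h2 h3 h4 h5
    have hfin := finite_typicalSet p H δ n
    set T := hfin.toFinset
    have hT : (T : Set (Fin n → α)) = typicalSet p H δ n := hfin.coe_toFinset
    have hTcard := card_le_of_subset_typicalSet T hT.subset
    have hS : MeasurableSet (⋃ r ∈ T, sqBall (f n r) (n * (s + δ * s))) :=
      Finset.measurableSet_biUnion _ fun r _ => measurableSet_sqBall _ _
    have hd' := (two_mul_abs_sub_le_varDist (jammedLaw p σ f n 0) (awgnLaw v n 0) hS).trans (h1 0)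
    rw [awgnLaw_zero] at hd'
    have hd := (le_abs_self _).trans ((le_div_iff₀' two_pos).2 hd')
    have hlow := mul_le_jammedLaw_real_biUnion_sqBall p σ f n T (n * (s + δ * s))
    have hup := noiseLaw_real_biUnion_sqBall_le (δ := δ) hv hs T (f n)
    have hQ : (noiseLaw v n).real {z | ∑ i, z i ^ 2 ≤ n * (v - δ * v)} ≤ 1 / 16 := by
      refine (measureReal_mono fun z hz => ?_).trans h4
      have hz : ∑ i, z i ^ 2 ≤ n * (v - δ * v) := hz
      rw [Set.mem_ofPred_eq]
      refine le_abs.2 (Or.inr ?_)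
      linarith
    have hcard : T.card * Real.exp (-(n * (C - δ))) ≤ 1 / 16 := by
      refine le_trans ?_ h5
      calc T.card * Real.exp (-(n * (C - δ)))
          ≤ Real.exp (n * (H + δ)) * Real.exp (-(n * (C - δ))) := by gcongr
        _ = Real.exp (-(n * (2 * δ))) := by
          rw [← Real.exp_add, hCδ]; congr 1; ring
    have hsrc : 15 / 16 ≤ (sourceLaw p n).real T := by
      have := probReal_compl_eq_one_sub (μ := sourceLaw p n) T.measurableSet
      rw [hT] at this ⊢
      linarith
    have hnoise : 15 / 16 ≤ (noiseLaw s n).real {w | ∑ i, w i ^ 2 < n * (s + δ * s)} := by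
      have hm : MeasurableSet {w : Fin n → ℝ | ∑ i, w i ^ 2 < n * (s + δ * s)} :=
        measurableSet_lt (by fun_prop) measurable_const
      have hc := probReal_compl_eq_one_sub (μ := noiseLaw s n) hm
      have : (noiseLaw s n).real {w | ∑ i, w i ^ 2 < n * (s + δ * s)}ᶜ ≤ 1 / 16 := by
        refine (measureReal_mono fun w hw => ?_).trans h3
        have hw : n * (s + δ * s) ≤ ∑ i, w i ^ 2 := not_lt.1 hw
        rw [Set.mem_ofPred_eq]
        refine le_abs.2 (Or.inl ?_)
        linarith
      linarith
    have hprod : (15 / 16 : ℝ) * (15 / 16) ≤ (sourceLaw p n).real T *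
        (noiseLaw s n).real {w | ∑ i, w i ^ 2 < n * (s + δ * s)} := by gcongr
    linarith
  exact hev.exists.elim fun _ h => h

end

/-! ### Binning the source into nearly uniform weights -/

/-- Greedy binning: atoms of mass at most `a` can be put into `M` bins of mass at most `b` until
either every atom is placed or every bin is full up to `a`. -/
theorem exists_binning {β : Type*} [MeasurableSpace β] (P : Measure β) [IsFiniteMeasure P] {a b : ℝ}
    (hb : 0 ≤ b) (M : ℕ) (T : Finset β) (ha : ∀ r ∈ T, P.real {r} ≤ a) :
    ∃ g : β → Option (Fin M), (∀ m, P.real (g ⁻¹' {some m}) ≤ b) ∧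
      ((∀ m, b - a < P.real (g ⁻¹' {some m})) ∨ ∀ r ∈ T, g r ≠ none) := by
  classical
  induction T using Finset.induction_on with
  | empty => exact ⟨fun _ => none, fun m => by simpa using hb, Or.inr (by simp)⟩
  | insert r T _ ih =>
    obtain ⟨g, hg, hfull⟩ := ih fun r' hr' => ha r' (Finset.mem_insert_of_mem hr')
    by_cases h1 : ∀ m, b - a < P.real (g ⁻¹' {some m})
    · exact ⟨g, hg, Or.inl h1⟩
    have hT := hfull.resolve_left h1
    -- Nothing in the induction hypothesis prevents `g` from having placed `r` already. Otherwise a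
    -- bin of mass at most `b - a` has room for it.
    by_cases h2 : g r = none
    · push Not at h1
      obtain ⟨m, hm⟩ := h1
      refine ⟨Function.update g r (some m), fun m' => ?_, Or.inr fun r' hr' => ?_⟩
      · by_cases hmm : m' = m
        · subst hmm
          have hsub : Function.update g r (some m') ⁻¹' {some m'} ⊆ g ⁻¹' {some m'} ∪ {r} := by
            intro x hx
            by_cases hxr : x = r
            · exact Or.inr hxr
            · exact Or.inl (by simpa [Function.update_of_ne hxr] using hx)
          have h3 := (measureReal_mono (μ := P) hsub).trans (measureReal_union_le _ _)
          have h4 := ha r (Finset.mem_insert_self _ _)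
          linarith
        · refine (measureReal_mono fun x hx => ?_).trans (hg m')
          by_cases hxr : x = r
          · subst hxr
            have : m = m' := by simpa using hx
            exact absurd this.symm hmm
          · simpa [Function.update_of_ne hxr] using hx
      · by_cases hrr : r' = r
        · subst hrr; simp
        · rw [Function.update_of_ne hrr]
          exact hT r' ((Finset.mem_insert.1 hr').resolve_left hrr)
    · refine ⟨g, hg, Or.inr fun r' hr' => ?_⟩
      rcases Finset.mem_insert.1 hr' with rfl | h
      · exact h2
      · exact hT r' h

/-- Binning of a finite set of small atoms, with control of the total mass of the bins. -/
theorem exists_binning_mass {β : Type*} [MeasurableSpace β] (P : Measure β) [IsFiniteMeasure P]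
    {a b : ℝ} (hb : 0 ≤ b) (M : ℕ) (T : Finset β) (ha : ∀ r ∈ T, P.real {r} ≤ a) :
    ∃ g : β → Option (Fin M), (∀ m, P.real (g ⁻¹' {some m}) ≤ b) ∧
      min (M * (b - a)) (P.real T) ≤ ∑ m, P.real (g ⁻¹' {some m}) := by
  obtain ⟨g, hg, h⟩ := exists_binning P hb M T ha
  refine ⟨g, hg, ?_⟩
  rcases h with h | h
  · refine (min_le_left _ _).trans ?_
    have := Finset.sum_le_sum fun m (_ : m ∈ Finset.univ) => (h m).le
    rwa [Finset.sum_const, Finset.card_univ, Fintype.card_fin, nsmul_eq_mul] at this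
  · refine (min_le_right _ _).trans ?_
    have hsub : (T : Set β) ⊆ ⋃ m ∈ (Finset.univ : Finset (Fin M)), g ⁻¹' {some m} := by
      intro r hr
      obtain ⟨m, hm⟩ := Option.ne_none_iff_exists'.1 (h r hr)
      simp only [Finset.mem_univ, Set.iUnion_true, Set.mem_iUnion]
      exact ⟨m, hm⟩
    exact (measureReal_mono hsub (measure_ne_top _ _)).trans (measureReal_biUnion_finset_le _ _)

theorem lintegral_comp_option {β : Type*} [MeasurableSpace β] [MeasurableSingletonClass β]
    [Countable β] (P : Measure β) {M : ℕ} (g : β → Option (Fin M)) (h : Option (Fin M) → ℝ≥0∞) :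
    ∫⁻ r, h (g r) ∂P = h none * P (g ⁻¹' {none}) + ∑ m, h (some m) * P (g ⁻¹' {some m}) := by
  let _ : MeasurableSpace (Option (Fin M)) := ⊤
  have hg : Measurable g := measurable_of_countable _
  rw [← lintegral_map (f := h) (measurable_of_countable _) hg, lintegral_fintype,
    Fintype.sum_option]
  simp_rw [Measure.map_apply hg (measurableSet_singleton _)]

/-! ### Soft covering by random codebooks with unequal weights -/

section SoftCovering

variable {E Z : Type*} [MeasurableSpace E] [MeasurableSpace Z] {γ : Measure E} {Q : Measure Z}
  [IsProbabilityMeasure γ] [IsProbabilityMeasure Q] {w : E → Z → ℝ} {B b : ℝ} {M : ℕ}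
  {G : Fin M → ℝ}

/-- The deviation at `z` of the output density of the codebook `c` with weights `G` from the
output density under the input law `γ`. -/
def codebookDeviation (γ : Measure E) (w : E → Z → ℝ) (G : Fin M → ℝ) (c : Fin M → E) (z : Z) : ℝ :=
  ∑ m, G m * (w (c m) z - ∫ e, w e z ∂γ)

theorem measurable_integral_left (hw : Measurable (Function.uncurry w)) :
    Measurable fun z => ∫ e, w e z ∂γ := by
  have h : StronglyMeasurable (Function.uncurry fun z e => w e z) :=
    (hw.comp measurable_swap).stronglyMeasurable
  exact h.integral_prod_right.measurable

theorem measurable_codebookDeviation (hw : Measurable (Function.uncurry w)) :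
    Measurable fun q : (Fin M → E) × Z => codebookDeviation γ w G q.1 q.2 := by
  unfold codebookDeviation
  refine Finset.measurable_sum _ fun m _ => measurable_const.mul (Measurable.sub ?_ ?_)
  · exact hw.comp (f := fun q : (Fin M → E) × Z => (q.1 m, q.2)) (by fun_prop)
  · exact (measurable_integral_left hw).comp measurable_snd

theorem integral_left_mem_Icc {Z : Type*} {w : E → Z → ℝ} (hw0 : ∀ e z, 0 ≤ w e z) (hwB : ∀ e z, w e z ≤ B) (z : Z) :
    0 ≤ ∫ e, w e z ∂γ ∧ ∫ e, w e z ∂γ ≤ B := by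
  refine ⟨integral_nonneg fun e => hw0 e z, ?_⟩
  have h := norm_integral_le_of_norm_le_const (μ := γ) (f := fun e => w e z) (C := B)
    (ae_of_all _ fun e => by rw [Real.norm_of_nonneg (hw0 e z)]; exact hwB e z)
  rw [probReal_univ, mul_one] at h
  exact (le_abs_self _).trans h

theorem abs_codebookDeviation_le {Z : Type*} {w : E → Z → ℝ} (hw0 : ∀ e z, 0 ≤ w e z) (hwB : ∀ e z, w e z ≤ B)
    (hG : ∀ m, 0 ≤ G m) (hG1 : ∑ m, G m ≤ 1) (c : Fin M → E) (z : Z) :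
    |codebookDeviation γ w G c z| ≤ B := by
  obtain ⟨hq0, hqB⟩ := integral_left_mem_Icc (γ := γ) hw0 hwB z
  have hB : 0 ≤ B := hq0.trans hqB
  calc |codebookDeviation γ w G c z| ≤ ∑ m, |G m * (w (c m) z - ∫ e, w e z ∂γ)| :=
        Finset.abs_sum_le_sum_abs _ _
    _ ≤ ∑ m, G m * B := by
        refine Finset.sum_le_sum fun m _ => ?_
        rw [abs_mul, abs_of_nonneg (hG m)]
        refine mul_le_mul_of_nonneg_left (abs_le.2 ⟨?_, ?_⟩) (hG m) <;>
          linarith [hw0 (c m) z, hwB (c m) z]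
    _ ≤ B := by
        rw [← Finset.sum_mul]
        exact mul_le_of_le_one_left hB hG1

theorem integrable_codebookDeviation_sq (hw : Measurable (Function.uncurry w))
    (hw0 : ∀ e z, 0 ≤ w e z) (hwB : ∀ e z, w e z ≤ B) (hG : ∀ m, 0 ≤ G m) (hG1 : ∑ m, G m ≤ 1) :
    Integrable (fun q : (Fin M → E) × Z => codebookDeviation γ w G q.1 q.2 ^ 2)
      ((Measure.pi fun _ : Fin M => γ).prod Q) := by
  refine Integrable.of_bound ((measurable_codebookDeviation hw).pow_const 2).aestronglyMeasurable
    (B ^ 2) (ae_of_all _ fun q => ?_)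
  rw [norm_pow, Real.norm_eq_abs]
  exact pow_le_pow_left₀ (abs_nonneg _) (abs_codebookDeviation_le hw0 hwB hG hG1 q.1 q.2) 2

/-- The variance, over the random choice of the codebook, of the output density at a point. -/
theorem integral_codebookDeviation_sq_le (hw : Measurable (Function.uncurry w))
    (hw0 : ∀ e z, 0 ≤ w e z) (hwB : ∀ e z, w e z ≤ B) (hG : ∀ m, 0 ≤ G m) (hGb : ∀ m, G m ≤ b)
    (hG1 : ∑ m, G m ≤ 1) (hb : 0 ≤ b) (z : Z) :
    ∫ c, codebookDeviation γ w G c z ^ 2 ∂(Measure.pi fun _ : Fin M => γ) ≤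
      b * B * ∫ e, w e z ∂γ := by
  obtain ⟨hq0, hqB⟩ := integral_left_mem_Icc (γ := γ) hw0 hwB z
  have hB : 0 ≤ B := hq0.trans hqB
  have hwz : Measurable fun e => w e z := hw.comp (measurable_id.prodMk measurable_const)
  have hbd : ∀ᵐ e ∂γ, ‖w e z‖ ≤ B := ae_of_all _ fun e => by
    rw [Real.norm_of_nonneg (hw0 e z)]; exact hwB e z
  have hint : Integrable (fun e => w e z) γ := Integrable.of_bound hwz.aestronglyMeasurable B hbd
  have hL2 : MemLp (fun e => w e z) 2 γ := MemLp.of_bound hwz.aestronglyMeasurable B hbd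
  -- The codewords are independent, so the variances add; this is where randomness of the codebook
  -- is used.
  have hvar := variance_sum_pi (μ := fun _ : Fin M => γ) (X := fun m e => G m * w e z)
    fun m => hL2.const_mul (G m)
  have hmean : ∫ c, ∑ m, G m * w (c m) z ∂(Measure.pi fun _ : Fin M => γ) =
      ∑ m, G m * ∫ e, w e z ∂γ := by
    rw [integral_finsetSum _ fun m _ => (integrable_comp_eval (μ := fun _ : Fin M => γ)
      (i := m) hint).const_mul (G m)]
    refine Finset.sum_congr rfl fun m _ => ?_
    rw [integral_const_mul, integral_comp_eval (μ := fun _ : Fin M => γ) (i := m)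
      (f := fun e => w e z) hwz.aestronglyMeasurable]
  have hsum : (∑ m, fun c : Fin M → E => G m * w (c m) z) = fun c => ∑ m, G m * w (c m) z := by
    ext c; simp
  rw [hsum, variance_eq_integral, hmean] at hvar
  · have hD : ∀ c : Fin M → E, codebookDeviation γ w G c z =
        ∑ m, G m * w (c m) z - ∑ m, G m * ∫ e, w e z ∂γ := fun c => by
      simp [codebookDeviation, mul_sub]
    simp_rw [hD, hvar]
    calc ∑ m, Var[fun e => G m * w e z; γ] ≤ ∑ m, G m * (b * B * ∫ e, w e z ∂γ) := by
          refine Finset.sum_le_sum fun m _ => ?_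
          rw [variance_const_mul]
          have h1 : Var[fun e => w e z; γ] ≤ B * ∫ e, w e z ∂γ := by
            refine (variance_le_expectation_sq hwz.aestronglyMeasurable).trans ?_
            rw [← integral_const_mul]
            refine integral_mono hL2.integrable_sq (hint.const_mul B) fun e => ?_
            have := mul_le_mul_of_nonneg_right (hwB e z) (hw0 e z)
            simpa [sq] using this
          -- One factor `G m` is traded for the bound `b`; the other is kept because the weights sum
          -- to at most one.
          calc G m ^ 2 * Var[fun e => w e z; γ] ≤ (G m * b) * (B * ∫ e, w e z ∂γ) := by
                rw [sq]
                exact mul_le_mul (mul_le_mul_of_nonneg_left (hGb m) (hG m)) h1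
                  (variance_nonneg _ _) (mul_nonneg (hG m) hb)
            _ = G m * (b * B * ∫ e, w e z ∂γ) := by ring
      _ ≤ b * B * ∫ e, w e z ∂γ := by
          rw [← Finset.sum_mul]
          exact mul_le_of_le_one_left (by positivity) hG1
  · have : Measurable fun c : Fin M → E => ∑ m, G m * w (c m) z :=
      Finset.measurable_sum _ fun m _ => (hwz.comp (measurable_pi_apply m)).const_mul _
    exact this.aemeasurable

theorem integrable_uncurry_of_bound (hw : Measurable (Function.uncurry w))
    (hw0 : ∀ e z, 0 ≤ w e z) (hwB : ∀ e z, w e z ≤ B) (ν : Measure Z) [IsFiniteMeasure ν] :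
    Integrable (Function.uncurry w) (γ.prod ν) :=
  Integrable.of_bound hw.aestronglyMeasurable B (ae_of_all _ fun q => by
    rw [Function.uncurry, Real.norm_of_nonneg (hw0 q.1 q.2)]; exact hwB q.1 q.2)

/-- After one factor `B` has been taken out, the density enters linearly and integrates to at most
one. With `b` about `1 / M`, the bound is small once `M` is well above `B`. -/
theorem integral_integral_codebookDeviation_sq_le (hw : Measurable (Function.uncurry w))
    (hw0 : ∀ e z, 0 ≤ w e z) (hwB : ∀ e z, w e z ≤ B) (hw1 : ∀ e, ∫ z, w e z ∂Q ≤ 1)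
    (hG : ∀ m, 0 ≤ G m) (hGb : ∀ m, G m ≤ b) (hG1 : ∑ m, G m ≤ 1) (hb : 0 ≤ b) (hB : 0 ≤ B) :
    ∫ c, ∫ z, codebookDeviation γ w G c z ^ 2 ∂Q ∂(Measure.pi fun _ : Fin M => γ) ≤ b * B := by
  have hint := integrable_codebookDeviation_sq (γ := γ) (Q := Q) hw hw0 hwB hG hG1
  have hwint := integrable_uncurry_of_bound (γ := γ) hw hw0 hwB Q
  rw [integral_integral_swap hint]
  calc ∫ z, ∫ c, codebookDeviation γ w G c z ^ 2 ∂(Measure.pi fun _ : Fin M => γ) ∂Q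
      ≤ ∫ z, b * B * ∫ e, w e z ∂γ ∂Q :=
        integral_mono hint.integral_prod_right (hwint.integral_prod_right.const_mul _)
          fun z => integral_codebookDeviation_sq_le hw hw0 hwB hG hGb hG1 hb z
    _ = b * B * ∫ e, ∫ z, w e z ∂Q ∂γ := by
        rw [integral_const_mul, integral_integral_swap hwint]
    _ ≤ b * B * 1 := by
        refine mul_le_mul_of_nonneg_left ?_ (by positivity)
        have := integral_mono (μ := γ) hwint.integral_prod_left (integrable_const 1) hw1
        simpa using this
    _ = b * B := mul_one _

/-- A codebook that approximates the output density and obeys a cost constraint exists as soon as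
the weights leave a little slack in the average cost. -/
theorem exists_codebook (hw : Measurable (Function.uncurry w))
    (hw0 : ∀ e z, 0 ≤ w e z) (hwB : ∀ e z, w e z ≤ B) (hw1 : ∀ e, ∫ z, w e z ∂Q ≤ 1)
    (hG : ∀ m, 0 ≤ G m) (hGb : ∀ m, G m ≤ b) (hb : 0 ≤ b) (hB : 0 ≤ B)
    {cost : E → ℝ} (hcost : Integrable cost γ) (hcost0 : ∀ e, 0 ≤ cost e)
    (hpos : 0 < ∫ e, cost e ∂γ) {η κ : ℝ} (hη : 0 ≤ η) (hGη : ∑ m, G m ≤ 1 - η) (hκ : 0 < κ)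
    (hbB : b * B ≤ η * κ) :
    ∃ c : Fin M → E, ∑ m, G m * cost (c m) ≤ ∫ e, cost e ∂γ ∧
      ∫ z, codebookDeviation γ w G c z ^ 2 ∂Q ≤ κ := by
  have hG1 : ∑ m, G m ≤ 1 := by linarith
  set K := ∫ e, cost e ∂γ
  -- The normalised cost has mean at most `1 - η` and the normalised deviation at most `η`. A
  -- codebook with `F` not above its mean has both nonnegative summands at most one.
  let F : (Fin M → E) → ℝ := fun c =>
    (∑ m, G m * cost (c m)) / K + (∫ z, codebookDeviation γ w G c z ^ 2 ∂Q) / κ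
  have hc : ∀ m : Fin M, Integrable (fun c : Fin M → E => G m * cost (c m))
      (Measure.pi fun _ : Fin M => γ) := fun m =>
    (integrable_comp_eval (μ := fun _ : Fin M => γ) (i := m) hcost).const_mul _
  have hi1 : Integrable (fun c : Fin M → E => (∑ m, G m * cost (c m)) / K)
      (Measure.pi fun _ : Fin M => γ) := (integrable_finsetSum _ fun m _ => hc m).div_const _
  have hi2 : Integrable (fun c : Fin M → E => (∫ z, codebookDeviation γ w G c z ^ 2 ∂Q) / κ)
      (Measure.pi fun _ : Fin M => γ) :=
    (integrable_codebookDeviation_sq (γ := γ) (Q := Q) hw hw0 hwB hG hG1).integral_prod_left.div_const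
      _
  obtain ⟨c, hcF⟩ := exists_le_integral (f := F) (hi1.add hi2)
  have hF : ∫ c, F c ∂(Measure.pi fun _ : Fin M => γ) ≤ 1 := by
    rw [integral_add hi1 hi2, integral_div, integral_div, integral_finsetSum _ fun m _ => hc m]
    have h1 : ∀ m : Fin M, ∫ c : Fin M → E, G m * cost (c m) ∂(Measure.pi fun _ : Fin M => γ) =
        G m * K := fun m => by
      rw [integral_const_mul, integral_comp_eval (μ := fun _ : Fin M => γ) (i := m)
        hcost.aestronglyMeasurable]
    simp_rw [h1]
    rw [← Finset.sum_mul, mul_div_cancel_right₀ _ hpos.ne']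
    have h2 := integral_integral_codebookDeviation_sq_le (γ := γ) (Q := Q) hw hw0 hwB hw1 hG hGb
      hG1 hb hB
    have h3 := (div_le_iff₀ hκ).2 (h2.trans hbB)
    linarith
  have hF1 := hcF.trans hF
  have hn1 : 0 ≤ (∑ m, G m * cost (c m)) / K :=
    div_nonneg (Finset.sum_nonneg fun m _ => mul_nonneg (hG m) (hcost0 _)) hpos.le
  have hn2 : 0 ≤ (∫ z, codebookDeviation γ w G c z ^ 2 ∂Q) / κ :=
    div_nonneg (integral_nonneg fun z => sq_nonneg _) hκ.le
  simp only [F] at hF1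
  exact ⟨c, (div_le_one hpos).1 (by linarith), (div_le_one hκ).1 (by linarith)⟩

/-- A small mean square deviation yields a lower bound on the output law of the codebook, on all
events at once. -/
theorem mul_setIntegral_sub_le (hw : Measurable (Function.uncurry w))
    (hw0 : ∀ e z, 0 ≤ w e z) (hwB : ∀ e z, w e z ≤ B) (hG : ∀ m, 0 ≤ G m) (hG1 : ∑ m, G m ≤ 1)
    {c : Fin M → E} {t : ℝ} (ht : 0 < t)
    (hV : ∫ z, codebookDeviation γ w G c z ^ 2 ∂Q ≤ t ^ 2) (s : Set Z) :
    (∑ m, G m) * ∫ z in s, ∫ e, w e z ∂γ ∂Q - t ≤ ∑ m, G m * ∫ z in s, w (c m) z ∂Q := by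
  have hwc : ∀ m, Integrable (fun z => w (c m) z) Q := fun m =>
    Integrable.of_bound (hw.comp (measurable_const.prodMk measurable_id)).aestronglyMeasurable B
      (ae_of_all _ fun z => by rw [Real.norm_of_nonneg (hw0 _ z)]; exact hwB _ z)
  have hq : Integrable (fun z => ∫ e, w e z ∂γ) Q :=
    (integrable_uncurry_of_bound hw hw0 hwB Q).integral_prod_right
  have hD : Integrable (fun z => codebookDeviation γ w G c z ^ 2) Q := by
    refine Integrable.of_bound (((measurable_codebookDeviation hw).comp
      (measurable_const.prodMk measurable_id)).pow_const 2).aestronglyMeasurable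
      (B ^ 2) (ae_of_all _ fun z => ?_)
    rw [norm_pow, Real.norm_eq_abs]
    exact pow_le_pow_left₀ (abs_nonneg _) (abs_codebookDeviation_le hw0 hwB hG hG1 c z) 2
  have hR : Integrable (fun z => t / 2 + codebookDeviation γ w G c z ^ 2 / (2 * t)) Q :=
    (integrable_const _).add (hD.div_const _)
  have hpt : ∀ z, (∑ m, G m) * (∫ e, w e z ∂γ) -
      (t / 2 + codebookDeviation γ w G c z ^ 2 / (2 * t)) ≤ ∑ m, G m * w (c m) z := fun z => by
    have h1 : codebookDeviation γ w G c z =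
        ∑ m, G m * w (c m) z - (∑ m, G m) * ∫ e, w e z ∂γ := by
      simp [codebookDeviation, mul_sub, Finset.sum_mul]
    -- Completing the square gives `-D ≤ t / 2 + D² / (2t)`, so a mean square of at most `t²` costs
    -- at most `t` on any event.
    have h2 : t / 2 + codebookDeviation γ w G c z ^ 2 / (2 * t) + codebookDeviation γ w G c z =
        (codebookDeviation γ w G c z + t) ^ 2 / (2 * t) := by field_simp; ring
    have h3 : 0 ≤ (codebookDeviation γ w G c z + t) ^ 2 / (2 * t) := by positivity
    linarith
  have hmono := integral_mono (μ := Q.restrict s)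
    ((hq.const_mul (∑ m, G m)).sub hR).restrict
    (integrable_finsetSum Finset.univ fun m _ => (hwc m).const_mul (G m)).restrict hpt
  have hR' : ∫ z in s, (t / 2 + codebookDeviation γ w G c z ^ 2 / (2 * t)) ∂Q ≤ t := by
    refine (setIntegral_le_integral hR (ae_of_all _ fun z => by positivity)).trans ?_
    rw [integral_add (integrable_const _) (hD.div_const _), integral_const, probReal_univ,
      one_smul, integral_div]
    have : (∫ z, codebookDeviation γ w G c z ^ 2 ∂Q) / (2 * t) ≤ t / 2 := by
      rw [div_le_div_iff₀ (by positivity) two_pos]; nlinarith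
    linarith
  rw [integral_finsetSum _ fun m _ => ((hwc m).const_mul (G m)).restrict] at hmono
  simp only [Pi.sub_apply] at hmono
  rw [integral_sub (hq.const_mul _).restrict hR.restrict, integral_const_mul] at hmono
  simp_rw [integral_const_mul] at hmono
  linarith

end SoftCovering

/-! ### The truncated Gaussian density and Gaussian codebooks -/

/-- The pairs of an input and an output of the Gaussian channel of noise variance `s` for which
neither the output is too long, for output variance `v`, nor the noise is too short. -/
def jointlyTypical (v s δ : ℝ) (n : ℕ) : Set ((Fin n → ℝ) × (Fin n → ℝ)) :=
  {q | ∑ i, q.2 i ^ 2 < n * (v + δ * v) ∧ n * (s - δ * s) < ∑ i, (q.2 i - q.1 i) ^ 2}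

theorem measurableSet_jointlyTypical (v s δ : ℝ) (n : ℕ) :
    MeasurableSet (jointlyTypical v s δ n) := by
  have h1 : Measurable fun q : (Fin n → ℝ) × (Fin n → ℝ) => ∑ i, q.2 i ^ 2 := by fun_prop
  have h2 : Measurable fun q : (Fin n → ℝ) × (Fin n → ℝ) => ∑ i, (q.2 i - q.1 i) ^ 2 := by
    fun_prop
  exact (measurableSet_lt h1 measurable_const).inter (measurableSet_lt measurable_const h2)

/-- The channel density, cut off outside the jointly typical pairs. -/
def typicalRatio (v s δ : ℝ) {n : ℕ} (c z : Fin n → ℝ) : ℝ :=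
  (jointlyTypical v s δ n).indicator (Function.uncurry (gaussianRatio v s)) (c, z)

theorem measurable_typicalRatio (v s δ : ℝ) (n : ℕ) :
    Measurable (Function.uncurry (typicalRatio v s δ : (Fin n → ℝ) → (Fin n → ℝ) → ℝ)) :=
  (measurable_gaussianRatio v s n).indicator (measurableSet_jointlyTypical v s δ n)

theorem typicalRatio_nonneg (v s δ : ℝ) {n : ℕ} (c z : Fin n → ℝ) : 0 ≤ typicalRatio v s δ c z :=
  Set.indicator_nonneg (fun q _ => gaussianRatio_nonneg v s q.1 q.2) _

/-- The cut-off controls both squared norms, which makes the bound uniform in `c` and `z`. It serves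
as the constant `B` of soft covering. -/
theorem typicalRatio_le {v s δ : ℝ} (hv : 0 < v) (hs : 0 < s) {n : ℕ} (c z : Fin n → ℝ) :
    typicalRatio v s δ c z ≤ Real.exp (n * (1 / 2 * Real.log (v / s) + δ)) := by
  refine Set.indicator_apply_le' (fun hq => ?_) fun _ => (Real.exp_pos _).le
  have h1 : ∑ i, z i ^ 2 < n * (v + δ * v) := hq.1
  have h2 : n * (s - δ * s) < ∑ i, (z i - c i) ^ 2 := hq.2
  rw [Function.uncurry, gaussianRatio, sqrt_pow_eq_exp (div_pos hv hs), ← Real.exp_add,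
    Real.exp_le_exp]
  have h3 : n * (1 - δ) / 2 ≤ (∑ i, (z i - c i) ^ 2) / (2 * s) := by
    rw [div_le_div_iff₀ two_pos (by positivity)]; nlinarith
  have h4 : (∑ i, z i ^ 2) / (2 * v) ≤ n * (1 + δ) / 2 := by
    rw [div_le_div_iff₀ (by positivity) two_pos]; nlinarith
  linarith

theorem setIntegral_typicalRatio {v s δ : ℝ} (hv : 0 < v) (hs : 0 < s) {n : ℕ} (c : Fin n → ℝ)
    {S : Set (Fin n → ℝ)} (hS : MeasurableSet S) :
    ∫ z in S, typicalRatio v s δ c z ∂noiseLaw v n =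
      (awgnLaw s n c).real (S ∩ Prod.mk c ⁻¹' jointlyTypical v s δ n) := by
  have hT : MeasurableSet (Prod.mk c ⁻¹' jointlyTypical v s δ n) :=
    measurable_prodMk_left (measurableSet_jointlyTypical v s δ n)
  have hm : Measurable fun z => typicalRatio v s δ c z :=
    (measurable_typicalRatio v s δ n).comp measurable_prodMk_left
  rw [integral_eq_lintegral_of_nonneg_ae (ae_of_all _ fun z => typicalRatio_nonneg v s δ c z)
    hm.aestronglyMeasurable, Measure.real, awgnLaw_eq_withDensity hv hs,
    withDensity_apply _ (hS.inter hT), Set.inter_comm, ← Measure.restrict_restrict hT,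
    ← lintegral_indicator hT]
  congr 1
  refine lintegral_congr fun z => ?_
  by_cases hz : (c, z) ∈ jointlyTypical v s δ n
  · rw [Set.indicator_of_mem (show z ∈ Prod.mk c ⁻¹' jointlyTypical v s δ n from hz), typicalRatio,
      Set.indicator_of_mem hz]
    rfl
  · rw [Set.indicator_of_notMem (show z ∉ Prod.mk c ⁻¹' jointlyTypical v s δ n from hz),
      typicalRatio, Set.indicator_of_notMem hz, ENNReal.ofReal_zero]

theorem setIntegral_typicalRatio_le {v s δ : ℝ} (hv : 0 < v) (hs : 0 < s) {n : ℕ} (c : Fin n → ℝ)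
    {S : Set (Fin n → ℝ)} (hS : MeasurableSet S) :
    ∫ z in S, typicalRatio v s δ c z ∂noiseLaw v n ≤ (awgnLaw s n c).real S := by
  rw [setIntegral_typicalRatio hv hs c hS]
  exact measureReal_mono Set.inter_subset_left

/-- The events on which the cut-off of the density loses mass. -/
theorem awgnLaw_real_sub_le_setIntegral_typicalRatio {v s δ : ℝ} (hv : 0 < v) (hs : 0 < s) {n : ℕ}
    (c : Fin n → ℝ) {S : Set (Fin n → ℝ)} (hS : MeasurableSet S) :
    (awgnLaw s n c).real (S ∩ {z | ∑ i, z i ^ 2 < n * (v + δ * v)}) -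
        (noiseLaw s n).real {w | n * (δ * s) ≤ |∑ i, w i ^ 2 - n * s|} ≤
      ∫ z in S, typicalRatio v s δ c z ∂noiseLaw v n := by
  rw [setIntegral_typicalRatio hv hs c hS, sub_le_iff_le_add]
  have hN : (awgnLaw s n c).real {z | ∑ i, (z i - c i) ^ 2 ≤ n * (s - δ * s)} ≤
      (noiseLaw s n).real {w | n * (δ * s) ≤ |∑ i, w i ^ 2 - n * s|} := by
    rw [awgnLaw, map_measureReal_apply (by fun_prop) (measurableSet_le (by fun_prop) (by fun_prop))]
    refine measureReal_mono fun w hw => ?_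
    simp only [Set.mem_preimage, Set.mem_ofPred_eq, Pi.add_apply, add_sub_cancel_left] at hw ⊢
    refine le_abs.2 (Or.inr ?_)
    linarith
  refine le_trans ?_ (add_le_add_right hN _)
  refine (measureReal_mono fun z hz => ?_).trans (measureReal_union_le _ _)
  by_cases h : n * (s - δ * s) < ∑ i, (z i - c i) ^ 2
  · exact Or.inl ⟨hz.1, hz.2, h⟩
  · exact Or.inr (not_lt.1 h)

theorem integral_awgnLaw_real {u s : ℝ} (hu : 0 ≤ u) (hs : 0 ≤ s) {n : ℕ} {A : Set (Fin n → ℝ)}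
    (hA : MeasurableSet A) :
    Integrable (fun c => (awgnLaw s n c).real A) (noiseLaw u n) ∧
      ∫ c, (awgnLaw s n c).real A ∂noiseLaw u n = (noiseLaw (u + s) n).real A := by
  have hadd : Measurable fun q : (Fin n → ℝ) × (Fin n → ℝ) => q.1 + q.2 := by fun_prop
  have h1 : ∀ c, awgnLaw s n c A =
      noiseLaw s n (Prod.mk c ⁻¹' ((fun q : (Fin n → ℝ) × (Fin n → ℝ) => q.1 + q.2) ⁻¹' A)) :=
    fun c => by rw [awgnLaw, Measure.map_apply (by fun_prop) hA]; rfl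
  have hm : Measurable fun c => awgnLaw s n c A := by
    simp_rw [h1]
    exact measurable_measure_prodMk_left (hadd hA)
  constructor
  · refine Integrable.of_bound hm.ennreal_toReal.aestronglyMeasurable 1 (ae_of_all _ fun c => ?_)
    rw [Real.norm_of_nonneg measureReal_nonneg]
    exact measureReal_le_one
  · rw [← noiseLaw_prod_map_add hu hs, map_measureReal_apply hadd hA, Measure.real,
      Measure.prod_apply (hadd hA)]
    simp_rw [Measure.real, h1]
    rw [integral_toReal]
    · exact (measurable_measure_prodMk_left (hadd hA)).aemeasurable
    · exact ae_of_all _ fun c => measure_lt_top _ _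

/-- Under Gaussian inputs of power `ρ` the cut-off output law is close to Gaussian noise. -/
theorem noiseLaw_real_sub_le_setIntegral_integral {s ρ δ : ℝ} (hs : 0 < s) (hρ : 0 < ρ) {n : ℕ}
    {S : Set (Fin n → ℝ)} (hS : MeasurableSet S) :
    (noiseLaw (s + ρ) n).real S -
        (noiseLaw (s + ρ) n).real {z | n * (δ * (s + ρ)) ≤ |∑ i, z i ^ 2 - n * (s + ρ)|} -
        (noiseLaw s n).real {w | n * (δ * s) ≤ |∑ i, w i ^ 2 - n * s|} ≤
      ∫ z in S, ∫ c, typicalRatio (s + ρ) s δ c z ∂noiseLaw ρ n ∂noiseLaw (s + ρ) n := by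
  set v := s + ρ
  have hv : 0 < v := by positivity
  have hint := integrable_uncurry_of_bound (γ := noiseLaw ρ n) (measurable_typicalRatio v s δ n)
    (typicalRatio_nonneg v s δ) (typicalRatio_le hv hs) ((noiseLaw v n).restrict S)
  set A : Set (Fin n → ℝ) := {z | ∑ i, z i ^ 2 < n * (v + δ * v)}
  have hA : MeasurableSet A := measurableSet_lt (by fun_prop) measurable_const
  obtain ⟨hi, hQ⟩ := integral_awgnLaw_real hρ.le hs.le (hS.inter hA)
  rw [add_comm ρ s] at hQ
  have hmono := integral_mono (hi.sub (integrable_const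
    ((noiseLaw s n).real {w | n * (δ * s) ≤ |∑ i, w i ^ 2 - n * s|}))) hint.integral_prod_left
    fun c => awgnLaw_real_sub_le_setIntegral_typicalRatio (δ := δ) hv hs c hS
  simp only [Pi.sub_apply] at hmono
  rw [integral_sub hi (integrable_const _), hQ, integral_const, probReal_univ, one_smul] at hmono
  rw [← integral_integral_swap hint]
  refine le_trans ?_ hmono
  have hS' : (noiseLaw v n).real S ≤ (noiseLaw v n).real (S ∩ A) +
      (noiseLaw v n).real {z | n * (δ * v) ≤ |∑ i, z i ^ 2 - n * v|} := by
    refine (measureReal_mono fun z hz => ?_).trans (measureReal_union_le _ _)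
    by_cases hzA : z ∈ A
    · exact Or.inl ⟨hz, hzA⟩
    · refine Or.inr ?_
      have : n * (v + δ * v) ≤ ∑ i, z i ^ 2 := not_lt.1 hzA
      rw [Set.mem_ofPred_eq]
      refine le_abs.2 (Or.inl ?_)
      linarith
  linarith

/-- Codebooks for given weights: cost at most `n * ρ` and an output law that dominates Gaussian
noise up to a small error on every event. -/
theorem exists_gaussian_codebook {s ρ δ b η t : ℝ} (hs : 0 < s) (hρ : 0 < ρ) {n M : ℕ} (hn : 0 < n)
    {G : Fin M → ℝ} (hG : ∀ m, 0 ≤ G m) (hGb : ∀ m, G m ≤ b) (hb : 0 ≤ b) (hη : 0 ≤ η)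
    (hGη : ∑ m, G m ≤ 1 - η) (ht : 0 < t)
    (hbB : b * Real.exp (n * (1 / 2 * Real.log ((s + ρ) / s) + δ)) ≤ η * t ^ 2) :
    ∃ c : Fin M → Fin n → ℝ, ∑ m, G m * ∑ i, c m i ^ 2 ≤ n * ρ ∧
      ∀ S, MeasurableSet S → (noiseLaw (s + ρ) n).real S - (1 - ∑ m, G m) -
        (noiseLaw (s + ρ) n).real {z | n * (δ * (s + ρ)) ≤ |∑ i, z i ^ 2 - n * (s + ρ)|} -
        (noiseLaw s n).real {w | n * (δ * s) ≤ |∑ i, w i ^ 2 - n * s|} - t ≤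
        ∑ m, G m * (awgnLaw s n (c m)).real S := by
  set v := s + ρ
  have hv : 0 < v := by positivity
  obtain ⟨hcost, hcost_eq⟩ := integral_sum_sq_noiseLaw hρ.le n
  have hw := measurable_typicalRatio v s δ n
  have hw0 := typicalRatio_nonneg v s δ (n := n)
  have hwB := typicalRatio_le (δ := δ) hv hs (n := n)
  have hG1 : ∑ m, G m ≤ 1 := by linarith
  obtain ⟨c, hc, hV⟩ := exists_codebook (γ := noiseLaw ρ n) (Q := noiseLaw v n) hw hw0 hwB
    (fun e => by
      have := setIntegral_typicalRatio_le (δ := δ) hv hs e MeasurableSet.univ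
      rw [setIntegral_univ] at this
      exact this.trans measureReal_le_one)
    hG hGb hb (Real.exp_pos _).le hcost (fun e => Finset.sum_nonneg fun i _ => sq_nonneg (e i))
    (by rw [hcost_eq]; positivity) hη hGη (sq_pos_of_pos ht) hbB
  refine ⟨c, by rwa [hcost_eq] at hc, fun S hS => ?_⟩
  have h1 := mul_setIntegral_sub_le (γ := noiseLaw ρ n) hw hw0 hwB hG hG1 ht hV S
  have h2 := noiseLaw_real_sub_le_setIntegral_integral (δ := δ) hs hρ hS
  have h3 : ∑ m, G m * ∫ z in S, typicalRatio v s δ (c m) z ∂noiseLaw v n ≤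
      ∑ m, G m * (awgnLaw s n (c m)).real S :=
    Finset.sum_le_sum fun m _ =>
      mul_le_mul_of_nonneg_left (setIntegral_typicalRatio_le hv hs (c m) hS) (hG m)
  have hg0 : 0 ≤ ∑ m, G m := Finset.sum_nonneg fun m _ => hG m
  have h4 := mul_le_mul_of_nonneg_left h2 hg0
  have h5 : (noiseLaw v n).real S ≤ 1 := measureReal_le_one
  have h6 : 0 ≤ (noiseLaw v n).real S := measureReal_nonneg
  have h7 : 0 ≤ (noiseLaw v n).real {z | n * (δ * v) ≤ |∑ i, z i ^ 2 - n * v|} :=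
    measureReal_nonneg
  have h8 : 0 ≤ (noiseLaw s n).real {w | n * (δ * s) ≤ |∑ i, w i ^ 2 - n * s|} :=
    measureReal_nonneg
  -- Multiplying by the total weight `g ≤ 1` costs at most `1 - g` on the main probability, and does
  -- not enlarge the error terms.
  nlinarith

/-! ### Achievability: from bins and codewords to a jammer -/

section

variable {α : Type*} [MeasurableSpace α] [MeasurableSingletonClass α] [Countable α]

/-- The interference that sends the codeword of the bin of the source sequence, and nothing for
source sequences outside the bins. -/
def binJammer {n M : ℕ} (g : (Fin n → α) → Option (Fin M)) (c : Fin M → Fin n → ℝ)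
    (r : Fin n → α) : Fin n → ℝ :=
  (g r).elim 0 c

/-- The extra codeword is the zero sequence, sent outside the bins. -/
theorem ncard_range_binJammer_le {α : Type*} {n M : ℕ} (g : (Fin n → α) → Option (Fin M))
    (c : Fin M → Fin n → ℝ) :
    (Set.range (binJammer g c)).Finite ∧ (Set.range (binJammer g c)).ncard ≤ M + 1 := by
  have hsub : Set.range (binJammer g c) ⊆ Set.range fun o : Option (Fin M) => o.elim 0 c := by
    rintro _ ⟨r, rfl⟩
    exact ⟨g r, rfl⟩
  have hfin := Set.finite_range fun o : Option (Fin M) => o.elim 0 c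
  refine ⟨hfin.subset hsub, (Set.ncard_le_ncard hsub hfin).trans ?_⟩
  rw [← Set.image_univ]
  refine (Set.ncard_image_le).trans ?_
  simp [Set.ncard_univ]

/-- Source sequences outside the bins send zero and use no power. -/
theorem lintegral_sq_binJammer_le (p : PMF α) {n M : ℕ} (g : (Fin n → α) → Option (Fin M))
    {c : Fin M → Fin n → ℝ} {P : ℝ}
    (h : ∑ m, (sourceLaw p n).real (g ⁻¹' {some m}) * ∑ i, c m i ^ 2 ≤ P) :
    ∫⁻ r, ENNReal.ofReal (∑ i, binJammer g c r i ^ 2) ∂sourceLaw p n ≤ ENNReal.ofReal P := by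
  have h1 := lintegral_comp_option (sourceLaw p n) g
    fun o => ENNReal.ofReal (∑ i, (o.elim 0 c : Fin n → ℝ) i ^ 2)
  have h2 : ENNReal.ofReal (∑ i, ((none : Option (Fin M)).elim 0 c : Fin n → ℝ) i ^ 2) = 0 := by
    simp
  rw [h2, zero_mul, zero_add] at h1
  unfold binJammer
  rw [h1]
  refine le_trans (le_of_eq ?_) (ENNReal.ofReal_le_ofReal h)
  rw [ENNReal.ofReal_sum_of_nonneg fun m _ =>
    mul_nonneg measureReal_nonneg (Finset.sum_nonneg fun i _ => sq_nonneg _)]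
  refine Finset.sum_congr rfl fun m _ => ?_
  rw [ENNReal.ofReal_mul measureReal_nonneg, ofReal_measureReal, mul_comm]
  rfl

/-- The contribution of the unbinned sequences is dropped: a one-sided bound on all events is all
that the distance needs. -/
theorem le_jammedLaw_real_of_eq_binJammer (p : PMF α) (σ : ℝ) {n M : ℕ} {f : Jammer α}
    {g : (Fin n → α) → Option (Fin M)} {c : Fin M → Fin n → ℝ} (hf : f n = binJammer g c)
    {S : Set (Fin n → ℝ)} (hS : MeasurableSet S) :
    ∑ m, (sourceLaw p n).real (g ⁻¹' {some m}) * (awgnLaw (σ ^ 2) n (c m)).real S ≤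
      (jammedLaw p σ f n 0).real S := by
  have h1 := lintegral_comp_option (sourceLaw p n) g
    fun o => awgnLaw (σ ^ 2) n (o.elim 0 c : Fin n → ℝ) S
  have h2 : jammedLaw p σ f n 0 S =
      ∫⁻ r, awgnLaw (σ ^ 2) n ((g r).elim 0 c : Fin n → ℝ) S ∂sourceLaw p n := by
    rw [jammedLaw_apply p σ f n 0 hS, hf]
    simp_rw [zero_add]
    rfl
  rw [Measure.real.eq_def (jammedLaw p σ f n 0), ← ENNReal.ofReal_le_iff_le_toReal
    (measure_ne_top _ _), h2, h1,
    ENNReal.ofReal_sum_of_nonneg fun m _ => mul_nonneg measureReal_nonneg measureReal_nonneg]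
  refine le_trans (Finset.sum_le_sum fun m _ => ?_) le_add_self
  rw [ENNReal.ofReal_mul measureReal_nonneg, ofReal_measureReal, ofReal_measureReal, mul_comm]
  rfl

/-- The interferences of block length `n` that obey the power and the rate constraint. -/
def admissible (p : PMF α) (ρ R : ℝ) (n : ℕ) : Set ((Fin n → α) → (Fin n → ℝ)) :=
  {φ | ∫⁻ r, ENNReal.ofReal (∑ i, φ r i ^ 2) ∂sourceLaw p n ≤ ENNReal.ofReal (n * ρ) ∧
    (Set.range φ).Finite ∧ ((Set.range φ).ncard : ℝ) ≤ Real.exp (n * R)}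

/-- Keeps the choice possible at block lengths too short for the random construction, where the
constraints must still hold. -/
theorem zero_mem_admissible {α : Type*} [MeasurableSpace α] (p : PMF α) (ρ : ℝ) {R : ℝ} (hR : 0 ≤ R) (n : ℕ) :
    (0 : (Fin n → α) → (Fin n → ℝ)) ∈ admissible p ρ R n := by
  have hsub : Set.range (0 : (Fin n → α) → (Fin n → ℝ)) ⊆ {0} := by
    rintro _ ⟨r, rfl⟩
    rfl
  refine ⟨by simp, (Set.finite_singleton _).subset hsub, ?_⟩
  have h1 := Set.ncard_le_ncard hsub
  rw [Set.ncard_singleton] at h1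
  calc ((Set.range (0 : (Fin n → α) → (Fin n → ℝ))).ncard : ℝ) ≤ 1 := by exact_mod_cast h1
    _ ≤ Real.exp (n * R) := Real.one_le_exp (by positivity)

/-- Achievability at one accuracy: below the entropy, good admissible interferences exist at all
large block lengths. -/
theorem eventually_exists_admissible {p : PMF α}
    (hp : Summable fun a => Real.negMulLog (p a).toReal) {σ ρ : ℝ} (hσ : 0 < σ) (hρ : 0 < ρ)
    (hH : 1 / 2 * Real.log ((σ ^ 2 + ρ) / σ ^ 2) < ∑' a, Real.negMulLog (p a).toReal)
    {τ : ℝ} (hτ : 0 < τ) {ε : ℝ} (hε : 0 < ε) :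
    ∀ᶠ n : ℕ in atTop,
      ∃ φ ∈ admissible p ρ (1 / 2 * Real.log ((σ ^ 2 + ρ) / σ ^ 2) + τ) n,
        ∀ f : Jammer α, f n = φ → ∀ S, MeasurableSet S →
          (noiseLaw (σ ^ 2 + ρ) n).real S ≤ (jammedLaw p σ f n 0).real S + ε := by
  have hs : 0 < σ ^ 2 := by positivity
  have hv : 0 < σ ^ 2 + ρ := by positivity
  set H := ∑' a, Real.negMulLog (p a).toReal
  set C := 1 / 2 * Real.log ((σ ^ 2 + ρ) / σ ^ 2) with hC
  have hC0 : 0 ≤ C := by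
    refine mul_nonneg (by norm_num) (Real.log_nonneg ?_)
    rw [le_div_iff₀ hs]
    linarith
  -- With `exp (n (C + 2d))` bins, atoms below `exp (-n (H - d))` and densities below `exp (n (C +
  -- d))`, both `M * a` and `b * B` are of order `exp (-nd)`. The condition `4 * d ≤ τ` leaves room
  -- for the rate.
  obtain ⟨d, hd, hdH, hdτ⟩ : ∃ d, 0 < d ∧ C + 4 * d ≤ H ∧ 4 * d ≤ τ :=
    ⟨min (H - C) τ / 4, by have := lt_min (sub_pos.2 hH) hτ; positivity,
      by have := min_le_left (H - C) τ; linarith, by have := min_le_right (H - C) τ; linarith⟩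
  -- The errors are at most `5 * t`: missing weight `2 * η ≤ 2 * t`, two atypicality events, and the
  -- covering error.
  set t := ε / 8 with ht_def
  have ht : 0 < t := by positivity
  obtain ⟨η, hη, hη1, hηt⟩ : ∃ η, 0 < η ∧ η ≤ 1 ∧ η ≤ t :=
    ⟨min 1 t, lt_min one_pos ht, min_le_left _ _, min_le_right _ _⟩
  have hexp : Tendsto (fun n : ℕ => Real.exp (-(n * d))) atTop (𝓝 0) :=
    Real.tendsto_exp_neg_atTop_nhds_zero.comp (tendsto_natCast_atTop_atTop.atTop_mul_const hd)
  filter_upwards [eventually_gt_atTop 0,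
    (tendsto_sourceLaw_real_compl_typicalSet hp hd).eventually_le_const hη,
    (tendsto_noiseLaw_real_abs_sum_sq_sub hs.le (mul_pos hd hs)).eventually_le_const ht,
    (tendsto_noiseLaw_real_abs_sum_sq_sub hv.le (mul_pos hd hv)).eventually_le_const ht,
    hexp.eventually_le_const hη,
    hexp.eventually_le_const (show 0 < η * t ^ 2 / 2 by positivity),
    hexp.eventually_le_const (show (0 : ℝ) < 1 / 2 by norm_num)]
    with n hn hsrc hnoise hout he1 he2 he3
  set e := Real.exp (-(n * d))
  set x := Real.exp (n * (C + 2 * d))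
  have hx1 : 1 ≤ x := Real.one_le_exp (by positivity)
  set M := ⌊x⌋₊
  have hM1 : 1 ≤ M := Nat.one_le_floor_iff _ |>.2 hx1
  have hMpos : (0 : ℝ) < M := by exact_mod_cast hM1
  have hMx : (M : ℝ) ≤ x := Nat.floor_le (Real.exp_pos _).le
  have hxM : x ≤ 2 * M := by
    have h1 := Nat.lt_floor_add_one x
    have h2 : (1 : ℝ) ≤ M := by exact_mod_cast hM1
    linarith
  have hfin := finite_typicalSet p H d n
  set T := hfin.toFinset
  have hT : (T : Set (Fin n → α)) = typicalSet p H d n := hfin.coe_toFinset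
  -- Even full bins then have total mass at most `1 - η`, the slack that pays for the exact power
  -- constraint.
  set b := (1 - η) / M
  have hb : 0 ≤ b := div_nonneg (by linarith) hMpos.le
  obtain ⟨g, hgb, hgmass⟩ := exists_binning_mass (sourceLaw p n)
    (a := Real.exp (-(n * (H - d)))) hb M T fun r hr => (hT.subset hr).2
  have hMb : M * b = 1 - η := mul_div_cancel₀ _ hMpos.ne'
  have hMa : M * Real.exp (-(n * (H - d))) ≤ η := by
    refine le_trans ?_ he1
    calc M * Real.exp (-(n * (H - d))) ≤ x * Real.exp (-(n * (H - d))) := by gcongr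
      _ = Real.exp (n * (C + 2 * d) - n * (H - d)) := by rw [← Real.exp_add]; rfl
      _ ≤ e := by
        refine Real.exp_le_exp.2 ?_
        have : (n : ℝ) * (C + 4 * d) ≤ n * H := by gcongr
        linarith
  have hTmass : 1 - η ≤ (sourceLaw p n).real T := by
    have := probReal_compl_eq_one_sub (μ := sourceLaw p n) T.measurableSet
    rw [hT] at this ⊢
    linarith
  have hmass : 1 - 2 * η ≤ ∑ m, (sourceLaw p n).real (g ⁻¹' {some m}) := by
    refine le_trans (le_min ?_ ?_) hgmass
    · rw [mul_sub, hMb]; linarith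
    · linarith
  have hmass' : ∑ m, (sourceLaw p n).real (g ⁻¹' {some m}) ≤ 1 - η := by
    have := Finset.sum_le_sum fun m (_ : m ∈ Finset.univ) => hgb m
    rwa [Finset.sum_const, Finset.card_univ, Fintype.card_fin, nsmul_eq_mul, hMb] at this
  have hbB : b * Real.exp (n * (C + d)) ≤ η * t ^ 2 := by
    have h1 : Real.exp (n * (C + d)) = x * e := by rw [← Real.exp_add]; congr 1; ring
    have he0 : 0 ≤ e := (Real.exp_pos _).le
    calc b * Real.exp (n * (C + d)) = b * x * e := by rw [h1, mul_assoc]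
      _ ≤ b * (2 * M) * e := by gcongr
      _ = 2 * (1 - η) * e := by rw [← hMb]; ring
      _ ≤ 2 * 1 * e := by gcongr; linarith
      _ ≤ η * t ^ 2 := by linarith
  obtain ⟨c, hpow, hc⟩ := exists_gaussian_codebook hs hρ hn (fun m => measureReal_nonneg) hgb hb
    hη.le hmass' ht hbB
  -- The zero codeword is absorbed by `M + 1 ≤ 2 * x` and `e ≤ 1 / 2`.
  have hcard : ((M + 1 : ℕ) : ℝ) ≤ Real.exp (n * (C + τ)) := by
    have h1 : x ≤ Real.exp (n * (C + τ)) * e := by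
      rw [← Real.exp_add]
      refine Real.exp_le_exp.2 ?_
      have : (n : ℝ) * (4 * d) ≤ n * τ := by gcongr
      have : 0 ≤ (n : ℝ) * d := by positivity
      linarith
    have h2 : Real.exp (n * (C + τ)) * e ≤ Real.exp (n * (C + τ)) * (1 / 2) := by gcongr
    push_cast
    linarith
  obtain ⟨hrf, hrc⟩ := ncard_range_binJammer_le g c
  refine ⟨binJammer g c, ⟨lintegral_sq_binJammer_le p g hpow, hrf,
    le_trans (by exact_mod_cast hrc) hcard⟩, fun f hf S hS => ?_⟩
  have h1 := hc S hS
  have h2 := le_jammedLaw_real_of_eq_binJammer p σ hf hS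
  linarith

/-- Choosing near-optimal elements makes a sequence that is good at every accuracy. -/
theorem exists_seq_forall_eventually_le {X : ℕ → Type*} (A : ∀ n, Set (X n))
    (hA : ∀ n, (A n).Nonempty) (D : ∀ n, X n → ℝ) (hD : ∀ n x, 0 ≤ D n x)
    (h : ∀ ε : ℝ, 0 < ε → ∀ᶠ n in atTop, ∃ x ∈ A n, D n x ≤ ε) :
    ∃ f : ∀ n, X n, (∀ n, f n ∈ A n) ∧ ∀ ε : ℝ, 0 < ε → ∀ᶠ n in atTop, D n (f n) ≤ ε := by
  -- The infimum need not be attained; the vanishing slack gives one choice that does not depend on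
  -- `ε`.
  have hex : ∀ n, ∃ x ∈ A n, D n x < sInf (D n '' A n) + 1 / ((n : ℝ) + 1) := fun n => by
    obtain ⟨_, ⟨x, hx, rfl⟩, hlt⟩ := exists_lt_of_csInf_lt ((hA n).image (D n))
      (lt_add_of_pos_right (sInf (D n '' A n)) (Nat.one_div_pos_of_nat (n := n)))
    exact ⟨x, hx, hlt⟩
  choose f hfA hf using hex
  refine ⟨f, hfA, fun ε hε => ?_⟩
  filter_upwards [h (ε / 2) (half_pos hε),
    tendsto_one_div_add_atTop_nhds_zero_nat.eventually_le_const (half_pos hε)] with n hn hn'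
  obtain ⟨x, hx, hxε⟩ := hn
  have h1 : sInf (D n '' A n) ≤ D n x :=
    csInf_le ⟨0, by rintro _ ⟨y, _, rfl⟩; exact hD n y⟩ ⟨x, hx, rfl⟩
  linarith [hf n]

theorem varDist_nonneg {Ω : Type*} [MeasurableSpace Ω] (μ ν : Measure Ω) : 0 ≤ varDist μ ν :=
  mul_nonneg zero_le_two (Real.iSup_nonneg fun _ => abs_nonneg _)

theorem varDist_jammedLaw_le_zero (p : PMF α) (σ v : ℝ) (f : Jammer α) (n : ℕ) (x : Fin n → ℝ) :
    varDist (jammedLaw p σ f n x) (awgnLaw v n x) ≤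
      varDist (jammedLaw p σ f n 0) (awgnLaw v n 0) := by
  have h := varDist_jammedLaw_le (p := p) (σ := σ) (v := v) (f := f) (n := n)
    (ε := varDist (jammedLaw p σ f n 0) (awgnLaw v n 0) / 2) (fun s hs => by
      have h1 := two_mul_abs_sub_le_varDist (jammedLaw p σ f n 0) (awgnLaw v n 0) hs
      rw [awgnLaw_zero] at h1 ⊢
      have h2 := neg_abs_le ((jammedLaw p σ f n 0).real s - (noiseLaw v n).real s)
      linarith) x
  linarith

/-- Passes from bits to nats, so the rate slack `δ` becomes `δ * log 2`. -/
theorem two_rpow_rate {s ρ δ : ℝ} (hs : 0 < s) (n : ℕ) :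
    (2 : ℝ) ^ (n * (1 / 2 * Real.logb 2 (1 + ρ / s) + δ)) =
      Real.exp (n * (1 / 2 * Real.log ((s + ρ) / s) + δ * Real.log 2)) := by
  have h1 : (s + ρ) / s = 1 + ρ / s := by field_simp
  have h2 : Real.log 2 ≠ 0 := (Real.log_pos one_lt_two).ne'
  rw [Real.rpow_def_of_pos two_pos, h1, Real.logb]
  congr 1
  field_simp

theorem canInduce_of_half_log_lt {p : PMF α}
    (hp : Summable fun a => Real.negMulLog (p a).toReal) {σ ρ : ℝ} (hσ : 0 < σ) (hρ : 0 < ρ)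
    (hH : 1 / 2 * Real.log ((σ ^ 2 + ρ) / σ ^ 2) < ∑' a, Real.negMulLog (p a).toReal) :
    CanInduce p σ ρ := by
  intro δ hδ
  have hs : 0 < σ ^ 2 := by positivity
  have hτ : 0 < δ * Real.log 2 := mul_pos hδ (Real.log_pos one_lt_two)
  set R := 1 / 2 * Real.log ((σ ^ 2 + ρ) / σ ^ 2) + δ * Real.log 2
  have hR : 0 ≤ R := by
    refine add_nonneg (mul_nonneg (by norm_num) (Real.log_nonneg ?_)) hτ.le
    rw [le_div_iff₀ hs]
    linarith
  obtain ⟨f, hfA, hf⟩ := exists_seq_forall_eventually_le (admissible p ρ R)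
    (fun n => ⟨0, zero_mem_admissible p ρ hR n⟩)
    -- A jammer is a family over all block lengths, but its law at `n` sees only `f n`; `φ` is
    -- therefore padded with zeros.
    (fun n φ => varDist (jammedLaw p σ (Function.update 0 n φ) n 0) (awgnLaw (σ ^ 2 + ρ) n 0))
    (fun n φ => varDist_nonneg _ _) (fun ε hε => by
      filter_upwards [eventually_exists_admissible hp hσ hρ hH hτ (half_pos hε)] with n hn
      obtain ⟨φ, hφ, h⟩ := hn
      refine ⟨φ, hφ, ?_⟩
      have := varDist_jammedLaw_le (h (Function.update 0 n φ) (by simp)) 0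
      linarith)
  refine ⟨f, fun n => (hfA n).1, fun n => ⟨(hfA n).2.1, ?_⟩, fun ε hε => ?_⟩
  · rw [two_rpow_rate hs]
    exact (hfA n).2.2
  · filter_upwards [hf ε hε] with n hn x
    have : jammedLaw p σ (Function.update 0 n (f n)) n 0 = jammedLaw p σ f n 0 := by
      simp only [jammedLaw, Function.update_self]
    rw [this] at hn
    exact (varDist_jammedLaw_le_zero p σ _ f n x).trans hn

/-- Power zero is separate because the codebook argument divides by the mean cost `n * ρ`; the
silent jammer is exact. -/
theorem canInduce_zero (p : PMF α) {σ : ℝ} : CanInduce p σ 0 := by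
  intro δ hδ
  have h0 := fun n => zero_mem_admissible p 0 (R := δ * Real.log 2)
    (mul_nonneg hδ.le (Real.log_nonneg one_le_two)) n
  refine ⟨0, fun n => (h0 n).1, fun n => ⟨(h0 n).2.1, (h0 n).2.2.trans (le_of_eq ?_)⟩,
    fun ε hε => Eventually.of_forall fun n x => ?_⟩
  · rw [Real.rpow_def_of_pos two_pos]
    congr 1
    simp
    ring
  · refine (varDist_jammedLaw_le (ε := 0) (fun S hS => ?_) x).trans (by linarith)
    rw [Measure.real, Measure.real, jammedLaw_apply p σ 0 n 0 hS]
    simp [awgnLaw_zero]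

theorem two_rpow_two_mul_entropyBits {α : Type*} (p : PMF α) :
    (2 : ℝ) ^ (2 * entropyBits p) = Real.exp (2 * ∑' a, Real.negMulLog (p a).toReal) := by
  have h2 : Real.log 2 ≠ 0 := (Real.log_pos one_lt_two).ne'
  rw [Real.rpow_def_of_pos two_pos, entropyBits]
  congr 1
  field_simp

theorem lt_maxPower_iff {s ρ H : ℝ} (hs : 0 < s) (hρ : 0 ≤ ρ) :
    ρ < s * (Real.exp (2 * H) - 1) ↔ 1 / 2 * Real.log ((s + ρ) / s) < H := by
  rw [one_div, inv_mul_lt_iff₀ two_pos, Real.log_lt_iff_lt_exp (by positivity), div_lt_iff₀ hs,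
    mul_sub, mul_one, lt_sub_iff_add_lt', mul_comm s]

theorem le_maxPower_iff {s ρ H : ℝ} (hs : 0 < s) (hρ : 0 ≤ ρ) :
    ρ ≤ s * (Real.exp (2 * H) - 1) ↔ 1 / 2 * Real.log ((s + ρ) / s) ≤ H := by
  rw [one_div, inv_mul_le_iff₀ two_pos, Real.log_le_iff_le_exp (by positivity), div_le_iff₀ hs,
    mul_sub, mul_one, le_sub_iff_add_le', mul_comm s]

end

end CoopJam

end

/-! ### The supremum of the inducible powers -/

theorem proposition2 {α : Type*} [Countable α] [MeasurableSpace α] [MeasurableSingletonClass α]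
    (p : PMF α) (hp : Summable fun a => Real.negMulLog (p a).toReal)
    (σ : ℝ) (hσ : 0 < σ) :
    (∀ ρ : ℝ, 0 ≤ ρ → ρ < σ ^ 2 * ((2 : ℝ) ^ (2 * CoopJam.entropyBits p) - 1) →
      CoopJam.CanInduce p σ ρ) ∧
    (∀ ρ : ℝ, 0 ≤ ρ → ∀ f : CoopJam.Jammer α, CoopJam.InducesGaussianNoise p σ ρ f →
      ρ ≤ σ ^ 2 * ((2 : ℝ) ^ (2 * CoopJam.entropyBits p) - 1)) ∧
    IsLUB {ρ : ℝ | 0 ≤ ρ ∧ CoopJam.CanInduce p σ ρ}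
      (σ ^ 2 * ((2 : ℝ) ^ (2 * CoopJam.entropyBits p) - 1)) := by
  have hs : 0 < σ ^ 2 := by positivity
  rw [CoopJam.two_rpow_two_mul_entropyBits]
  set P := σ ^ 2 * (Real.exp (2 * ∑' a, Real.negMulLog (p a).toReal) - 1)
  have hach : ∀ ρ : ℝ, 0 ≤ ρ → ρ < P → CoopJam.CanInduce p σ ρ := fun ρ hρ hlt => by
    rcases hρ.eq_or_lt with rfl | hpos
    · exact CoopJam.canInduce_zero p
    · exact CoopJam.canInduce_of_half_log_lt hp hσ hpos ((CoopJam.lt_maxPower_iff hs hρ).1 hlt)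
  have hconv : ∀ ρ : ℝ, 0 ≤ ρ → ∀ f : CoopJam.Jammer α, CoopJam.InducesGaussianNoise p σ ρ f →
      ρ ≤ P := fun ρ hρ f hf =>
    (CoopJam.le_maxPower_iff hs hρ).2 (CoopJam.half_log_le_of_inducesGaussianNoise hp hσ hρ hf)
  refine ⟨hach, hconv, fun ρ hρ => ?_, fun u hu => ?_⟩
  -- Any rate slack would do, since the converse ignores rate and power.
  · obtain ⟨f, -, -, hf⟩ := hρ.2 1 one_pos
    exact hconv ρ hρ.1 f hf
  -- Power zero is always inducible, so upper bounds are nonnegative and the intermediate `ρ` is an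
  -- allowed power.
  · have h0 : 0 ≤ u := hu ⟨le_rfl, CoopJam.canInduce_zero p⟩
    by_contra! hlt
    obtain ⟨ρ, huρ, hρ⟩ := exists_between hlt
    have hρ0 : 0 ≤ ρ := h0.trans huρ.le
    exact huρ.not_ge (hu ⟨hρ0, hach ρ hρ0 hρ⟩)
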